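/- Let $K\subset\mathbb{R}^2$ be a compact strictly convex set whose boundary is a smooth ($C^\infty$) regular simple closed curve $\gamma$ with everywhere positive curvature (with respect to the counterclockwise orientation). Let $p_K(\theta)=\max_{x\in K}\langle x,(\cos\theta,\sin\theta)\rangle$ be the support function of $K$, and parametrize $\gamma$ by the angle $\theta\in[0,2\pi]$ between the $x$-axis and the outward normal, $$\gamma(\theta)=\bigl(p_K\cos\theta-p_K'\sin\theta,\ p_K\sin\theta+p_K'\cos\theta\bigr).$$ Let $\kappa(\theta)$ be the curvature and $\rho(\theta)=1/\kappa(\theta)$ the curvature radius of $\gamma$, let $\rho_M,\rho_m$ be the maximum and minimum of $\rho$, let $L$ be the length of $\gamma$, $A$ the area of $K$, and $\rho_e,\rho_i$ the circumradius and inradius of $K$ (the least radius of a disk containing $K$ and the greatest radius of a disk contained in $K$). Let $\beta(\theta)=\gamma(\theta)-\rho(\theta)(\cos\theta,\sin\theta)$ be the locus of curvature centers of $\gamma$, let $\tilde A=\frac12\oint_\beta \beta_1\,d\beta_2-\beta_2\,d\beta_1$ be its oriented area, and let $\rho_\beta(\theta)=|p_K'(\theta)+p_K'''(\theta)|$ be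 its curvature radius, that is, the reciprocal of the absolute curvature of $\beta$ where $\beta'(\theta)\neq0$, and $0$ where $\beta'(\theta)=0$. For real parameters $\alpha,\delta,\mu,\sigma,\eta,\lambda,\xi,\zeta$ put $$W=\alpha\int_0^{2\pi}\rho(\theta)^2\,d\theta+\delta L^2+\mu A+\sigma|\tilde A|+\eta\int_0^{2\pi}\rho_\beta(\theta)^2\,d\theta+\lambda(\rho_e-\rho_i)^2+\xi(\rho_M-\rho_m)^2+\zeta\oint_\gamma\kappa^2\,ds .$$ Consider the conditions $$(\ast)\qquad\begin{cases}\eta,\xi,\zeta\ge0,\qquad \lambda\le0,\\ 2\alpha+4\pi\delta+\mu-4\zeta\ge0,\\ 2\alpha+\sigma-2\eta-4\zeta\ge0,\\ 6\pi\alpha-\pi\mu+4\pi\sigma+24\pi\eta+4\lambda+4\xi-12\pi\zeta\ge0.\end{cases}$$ (i) If the parameters satisfy $(\ast)$, then $W\ge0$. (ii) If $K$ is a disk and $2\alpha+4\pi\delta+\mu=0$, $\zeta=0$, then $W=0$. (iii) If the parameters satisfy $(\ast)$ and $\lambda^2+\xi^2+\zeta^2>0$, and if $W=0$, then $K$ is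 a disk. -/

import Mathlib

open scoped ContDiff

/-- The Euclidean plane. -/
abbrev Plane : Type := EuclideanSpace ℝ (Fin 2)

noncomputable section

namespace PlaneCurve

/-- The curve `c` is smooth, regular, closed with period `T`, and simple. -/
structure IsSmoothSimpleClosed (c : ℝ → Plane) (T : ℝ) : Prop where
  period_pos : 0 < T
  smooth : ContDiff ℝ ∞ c
  periodic : Function.Periodic c T
  injOn : Set.InjOn c (Set.Ico 0 T)
  regular : ∀ t, deriv c t ≠ 0

/-- Signed curvature `(c₁' c₂'' - c₂' c₁'') / (c₁'² + c₂'²) ^ (3/2)` of a plane curve. -/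
def curvature (c : ℝ → Plane) (t : ℝ) : ℝ :=
  (deriv (fun s => c s 0) t * deriv (deriv (fun s => c s 1)) t
      - deriv (fun s => c s 1) t * deriv (deriv (fun s => c s 0)) t)
    / ((deriv (fun s => c s 0) t) ^ 2 + (deriv (fun s => c s 1) t) ^ 2) ^ (3 / 2 : ℝ)

/-- Integral of `f` over the curve `c`, `t ∈ [0, 2π]`, against arc length. -/
def arcIntegral (c : ℝ → Plane) (f : ℝ → ℝ) : ℝ :=
  ∫ t in (0 : ℝ)..(2 * Real.pi), f t * ‖deriv c t‖

/-- Oriented area `½ ∮ c₁ dc₂ - c₂ dc₁` enclosed by the closed curve `c`, `t ∈ [0, 2π]`. -/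
def orientedArea (c : ℝ → Plane) : ℝ :=
  (1 / 2) * ∫ t in (0 : ℝ)..(2 * Real.pi),
    (c t 0 * deriv (fun s => c s 1) t - c t 1 * deriv (fun s => c s 0) t)

end PlaneCurve

namespace ConvexDomain

/-- The unit vector `(cos θ, sin θ)`. -/
def normal (θ : ℝ) : Plane := !₂[Real.cos θ, Real.sin θ]

/-- The support function `p_K` of `K`, as a function of the angle of the outward normal. -/
def supportFn (K : Set Plane) (θ : ℝ) : ℝ :=
  sSup ((fun x : Plane => inner ℝ (normal θ) x) '' K)

/-- The parametrization of the boundary curve `γ` of `K` by the angle `θ` of its outward normal. -/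
def bdry (K : Set Plane) (θ : ℝ) : Plane :=
  !₂[supportFn K θ * Real.cos θ - deriv (supportFn K) θ * Real.sin θ,
     supportFn K θ * Real.sin θ + deriv (supportFn K) θ * Real.cos θ]

/-- The curvature `κ` of the boundary curve. -/
def kappa (K : Set Plane) (θ : ℝ) : ℝ := PlaneCurve.curvature (bdry K) θ

/-- The curvature radius `ρ` of the boundary curve. -/
def rho (K : Set Plane) (θ : ℝ) : ℝ := 1 / kappa K θ

/-- The length `L` of the boundary curve. -/
def length (K : Set Plane) : ℝ := PlaneCurve.arcIntegral (bdry K) (fun _ => 1)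

/-- The area `A` of `K`. -/
def area (K : Set Plane) : ℝ := (MeasureTheory.volume K).toReal

/-- The locus `β` of the curvature centers of the boundary curve. -/
def centers (K : Set Plane) (θ : ℝ) : Plane := bdry K θ - rho K θ • normal θ

/-- The oriented area `Ã` enclosed by the locus of curvature centers. -/
def areaTilde (K : Set Plane) : ℝ := PlaneCurve.orientedArea (centers K)

open Classical in
/-- The curvature radius `ρ_β` of the locus `β` of curvature centers: the reciprocal of the
absolute curvature of `β` where `β` is regular, and `0` at the singular points of `β`
(the two cases together are the continuous function `|p_K' + p_K'''|`). -/
def rhoBeta (K : Set Plane) (θ : ℝ) : ℝ :=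
  if deriv (centers K) θ = 0 then 0 else |1 / PlaneCurve.curvature (centers K) θ|

/-- The circumradius `ρ_e`. -/
def circumradius (K : Set Plane) : ℝ :=
  sInf {R : ℝ | 0 ≤ R ∧ ∃ x : Plane, K ⊆ Metric.closedBall x R}

/-- The inradius `ρ_i`. -/
def inradius (K : Set Plane) : ℝ :=
  sSup {r : ℝ | 0 ≤ r ∧ ∃ x : Plane, Metric.closedBall x r ⊆ K}

/-- The maximum `ρ_M` of the curvature radius. -/
def rhoMax (K : Set Plane) : ℝ := sSup (Set.range (rho K))

/-- The minimum `ρ_m` of the curvature radius. -/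
def rhoMin (K : Set Plane) : ℝ := sInf (Set.range (rho K))

/-- `K` is a disk. -/
def IsDisk (K : Set Plane) : Prop :=
  ∃ (x : Plane) (r : ℝ), 0 < r ∧ K = Metric.closedBall x r

/-- The functional `W`. -/
def W (K : Set Plane) (α δ μ σ η lam ξ ζ : ℝ) : ℝ :=
  α * (∫ θ in (0 : ℝ)..(2 * Real.pi), rho K θ ^ 2)
    + δ * length K ^ 2
    + μ * area K
    + σ * |areaTilde K|
    + η * (∫ θ in (0 : ℝ)..(2 * Real.pi), rhoBeta K θ ^ 2)
    + lam * (circumradius K - inradius K) ^ 2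
    + ξ * (rhoMax K - rhoMin K) ^ 2
    + ζ * PlaneCurve.arcIntegral (bdry K) (fun θ => kappa K θ ^ 2)

/-- The linear conditions on the parameters. -/
structure Admissible (α δ μ σ η lam ξ ζ : ℝ) : Prop where
  eta_nonneg : 0 ≤ η
  xi_nonneg : 0 ≤ ξ
  zeta_nonneg : 0 ≤ ζ
  lam_nonpos : lam ≤ 0
  cond₁ : 0 ≤ 2 * α + 4 * Real.pi * δ + μ - 4 * ζ
  cond₂ : 0 ≤ 2 * α + σ - 2 * η - 4 * ζ
  cond₃ : 0 ≤ 6 * Real.pi * α - Real.pi * μ + 4 * Real.pi * σ + 24 * Real.pi * η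
    + 4 * lam + 4 * ξ - 12 * Real.pi * ζ

end ConvexDomain

end

noncomputable section

namespace ConvexDomain

open Real MeasureTheory intervalIntegral

/-! Everything is expressed through the support function p and the curvature radius ρ = p + p''. Put
Q = ∫ pρ (twice the area), D = L²/4π − A (the isoperimetric deficit), S = ∫ (ρ − L/2π)² and U = ∫
ρ'². Then ∫ ρ² = S + L²/2π, |Ã| = S/2 + D and ∫ ρ_β² = U. Hence W is linear in L²/4π, S, D, U, the
two squared differences of radii and the curvature integral (`W_eq`).

Four inequalities carry the proof. Fourier series give U ≥ 4S (`four_mul_variance_le`) and S ≥ 6D ≥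
0 (`deficit_bounds`), because ρ − L/2π has only modes of order at least two. Popoviciu's inequality
gives S ≤ (π/2)(ρ_M − ρ_m)² (`variance_le`). Bonnesen's inequality gives π(ρ_e − ρ_i)² ≤ 4D
(`bonnesen_radii`). The conditions on the parameters are exactly of the shape needed to write πW as
a sum of nonnegative multiples of these differences, of L², of D and of the curvature integral
(`W_lower_bound`).

Bonnesen's inequality comes from a Wirtinger inequality. An optimal circle, inscribed or
circumscribed, touches the boundary on every closed half circle of normals, since otherwise a
translation would improve it. So g = p − (u cos + v sin) − r has three zeros cutting the circle into
arcs of length at most π, and the Dirichlet Wirtinger inequality on each arc gives ∫ g² ≤ ∫ g'².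
Integration by parts turns this into Q − 2rL + 2πr² ≤ 0 for both radii r. Equality forces g + g'' =
0, that is, ρ = r constant.

If W = 0, all the nonnegative terms vanish. When ζ > 0 this is impossible, since the curvature
integral is positive. When λ < 0, Bonnesen's inequality is an equality. When ξ > 0, first D and then
ρ_M − ρ_m vanish. In the last two cases ρ is constant and K is a disk. What remains is to pass from
the given boundary curve to a smooth p with ρ > 0 (`isOval_of_curve`), and to prove A = Q/2 for
Lebesgue measure (`area_eq`). -/

/-- A smooth `2π`-periodic real function. -/
structure SmoothPeriodic (f : ℝ → ℝ) : Prop where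
  smooth : ContDiff ℝ ∞ f
  periodic : Function.Periodic f (2 * π)

/-! ### Calculus of smooth periodic functions. -/

namespace SmoothPeriodic

variable {f g : ℝ → ℝ}

protected theorem continuous (hf : SmoothPeriodic f) : Continuous f := hf.smooth.continuous

protected theorem differentiable (hf : SmoothPeriodic f) : Differentiable ℝ f :=
  hf.smooth.differentiable (by simp)

protected theorem hasDerivAt (hf : SmoothPeriodic f) (x : ℝ) : HasDerivAt f (_root_.deriv f x) x :=
  (hf.differentiable x).hasDerivAt

protected theorem intervalIntegrable (hf : SmoothPeriodic f) (a b : ℝ) :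
    IntervalIntegrable f volume a b :=
  hf.continuous.intervalIntegrable a b

protected theorem deriv (hf : SmoothPeriodic f) : SmoothPeriodic (deriv f) where
  smooth := by
    have := hf.smooth
    rw [contDiff_infty_iff_deriv] at this
    exact this.2
  periodic := fun x => by
    have h : (fun y => f (y + 2 * π)) = f := funext hf.periodic
    rw [← deriv_comp_add_const, h]

protected theorem add (hf : SmoothPeriodic f) (hg : SmoothPeriodic g) :
    SmoothPeriodic (fun x => f x + g x) :=
  ⟨hf.smooth.add hg.smooth, hf.periodic.add hg.periodic⟩

protected theorem sub (hf : SmoothPeriodic f) (hg : SmoothPeriodic g) :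
    SmoothPeriodic (fun x => f x - g x) :=
  ⟨hf.smooth.sub hg.smooth, hf.periodic.sub hg.periodic⟩

protected theorem mul (hf : SmoothPeriodic f) (hg : SmoothPeriodic g) :
    SmoothPeriodic (fun x => f x * g x) :=
  ⟨hf.smooth.mul hg.smooth, hf.periodic.mul hg.periodic⟩

protected theorem neg (hf : SmoothPeriodic f) : SmoothPeriodic (fun x => -f x) :=
  ⟨hf.smooth.neg, fun x => by rw [hf.periodic]⟩

protected theorem const (c : ℝ) : SmoothPeriodic (fun _ => c) := ⟨contDiff_const, fun _ => rfl⟩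

protected theorem pow (hf : SmoothPeriodic f) (n : ℕ) : SmoothPeriodic (fun x => f x ^ n) :=
  ⟨hf.smooth.pow n, fun x => by rw [hf.periodic]⟩

protected theorem cos : SmoothPeriodic Real.cos := ⟨Real.contDiff_cos, Real.cos_periodic⟩

protected theorem sin : SmoothPeriodic Real.sin := ⟨Real.contDiff_sin, Real.sin_periodic⟩

theorem comp_sub_const (hf : SmoothPeriodic f) (c : ℝ) : SmoothPeriodic (fun x => f (x - c)) :=
  ⟨hf.smooth.comp (contDiff_id.sub contDiff_const), fun x => by
    rw [show x + 2 * π - c = x - c + 2 * π by ring, hf.periodic]⟩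

theorem integral_deriv_eq_zero (hf : SmoothPeriodic f) :
    ∫ x in (0 : ℝ)..(2 * π), _root_.deriv f x = 0 := by
  rw [integral_deriv_eq_sub (fun x _ => hf.differentiable x) (hf.deriv.intervalIntegrable _ _)]
  have := hf.periodic 0
  rw [zero_add] at this
  rw [this, sub_self]

theorem integral_mul_deriv (hf : SmoothPeriodic f) (hg : SmoothPeriodic g) :
    ∫ x in (0 : ℝ)..(2 * π), f x * _root_.deriv g x
      = -∫ x in (0 : ℝ)..(2 * π), _root_.deriv f x * g x := by
  rw [integral_mul_deriv_eq_deriv_mul (fun x _ => hf.hasDerivAt x) (fun x _ => hg.hasDerivAt x)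
    (hf.deriv.intervalIntegrable _ _) (hg.deriv.intervalIntegrable _ _)]
  have h1 := hf.periodic 0
  have h2 := hg.periodic 0
  rw [zero_add] at h1 h2
  rw [h1, h2]
  ring

/-- A smooth periodic function attains all its values on one period. -/
theorem exists_mem_Icc (hf : SmoothPeriodic f) (a x : ℝ) :
    ∃ y ∈ Set.Icc a (a + 2 * π), f y = f x := by
  obtain ⟨y, hy, h⟩ := hf.periodic.exists_mem_Ico two_pi_pos x a
  exact ⟨y, Set.Ico_subset_Icc_self hy, h.symm⟩

theorem isCompact_range (hf : SmoothPeriodic f) : IsCompact (Set.range f) :=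
  hf.periodic.compact_of_continuous two_pi_pos.ne' hf.continuous

/-- A nonnegative smooth periodic function with zero integral vanishes. -/
theorem eq_zero_of_integral_eq_zero (hf : SmoothPeriodic f) (h0 : ∀ x, 0 ≤ f x)
    (hi : ∫ x in (0 : ℝ)..(2 * π), f x = 0) (x : ℝ) : f x = 0 := by
  by_contra hx
  have hx' : 0 < f x := lt_of_le_of_ne (h0 x) (Ne.symm hx)
  obtain ⟨y, hy, hyx⟩ := hf.exists_mem_Icc 0 x
  rw [zero_add] at hy
  have := integral_pos two_pi_pos hf.continuous.continuousOn (fun z _ => h0 z)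
    ⟨y, hy, by rw [hyx]; exact hx'⟩
  exact absurd hi this.ne'

end SmoothPeriodic

/-! ### Wirtinger inequalities and their equality case. -/

/-- The Wirtinger inequality for functions without Fourier modes of order at most one. -/
theorem four_mul_integral_sq_le {w : ℝ → ℝ} (hw : SmoothPeriodic w)
    (h0 : ∫ x in (0 : ℝ)..(2 * π), w x = 0)
    (hc : ∫ x in (0 : ℝ)..(2 * π), w x * cos x = 0)
    (hs : ∫ x in (0 : ℝ)..(2 * π), w x * sin x = 0) :
    4 * ∫ x in (0 : ℝ)..(2 * π), w x ^ 2 ≤ ∫ x in (0 : ℝ)..(2 * π), deriv w x ^ 2 := by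
  have hcW : Continuous (fun x => (w x : ℂ)) := Complex.continuous_ofReal.comp hw.continuous
  have hcD : Continuous (fun x => ((deriv w x : ℝ) : ℂ)) :=
    Complex.continuous_ofReal.comp hw.deriv.continuous
  have hL : ∀ {F : ℝ → ℂ}, Continuous F → MemLp F 2 (volume.restrict (Set.Ioc 0 (2 * π))) := by
    intro F hF
    obtain ⟨C, hC⟩ := isCompact_Icc.exists_bound_of_continuousOn
      (s := Set.Icc 0 (2 * π)) hF.continuousOn
    refine MemLp.of_bound hF.aestronglyMeasurable C ?_
    filter_upwards [ae_restrict_mem measurableSet_Ioc] with x hx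
    exact hC x (Set.Ioc_subset_Icc_self hx)
  have s1 := hasSum_sq_fourierCoeffOn two_pi_pos (hL hcW)
  have s2 := hasSum_sq_fourierCoeffOn two_pi_pos (hL hcD)
  have hexp : ∀ (n : ℤ) (x : ℝ), fourier (-n) (x : AddCircle (2 * π - 0))
      = Complex.exp (-(n * x) * Complex.I) := by
    intro n x
    rw [fourier_coe_apply]
    congr 1
    have : (π : ℂ) ≠ 0 := by exact_mod_cast pi_ne_zero
    push_cast
    field_simp
    ring
  have key : ∀ n : ℤ, 4 * ‖fourierCoeffOn two_pi_pos (fun x => (w x : ℂ)) n‖ ^ 2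
      ≤ ‖fourierCoeffOn two_pi_pos (fun x => ((deriv w x : ℝ) : ℂ)) n‖ ^ 2 := by
    intro n
    -- By Parseval it suffices to compare coefficients. Differentiation multiplies the n-th one by
    -- in, of modulus at least 2 here; the coefficients with |n| ≤ 1 vanish by the orthogonality
    -- hypotheses.
    by_cases hn : 2 ≤ |n|
    · have hn0 : n ≠ 0 := by rintro rfl; simp at hn
      have hd := fourierCoeffOn_of_hasDerivAt two_pi_pos hn0
        (f := fun x => (w x : ℂ)) (f' := fun x => ((deriv w x : ℝ) : ℂ))
        (fun x _ => (hw.hasDerivAt x).ofReal_comp) (hcD.intervalIntegrable _ _)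
      have hp := hw.periodic 0
      rw [zero_add] at hp
      rw [hp, sub_self, mul_zero, zero_sub] at hd
      have hd' : fourierCoeffOn two_pi_pos (fun x => ((deriv w x : ℝ) : ℂ)) n
          = (Complex.I * n) * fourierCoeffOn two_pi_pos (fun x => (w x : ℂ)) n := by
        rw [hd]
        have h1 : (π : ℂ) ≠ 0 := by exact_mod_cast pi_ne_zero
        have h2 : (n : ℂ) ≠ 0 := by exact_mod_cast hn0
        have h3 := Complex.I_ne_zero
        push_cast
        field_simp
        ring
      rw [hd', norm_mul, norm_mul, Complex.norm_I, one_mul, mul_pow, Complex.norm_intCast]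
      have : (2 : ℝ) ≤ |(n : ℝ)| := by exact_mod_cast hn
      have h4 : (4 : ℝ) ≤ |(n : ℝ)| ^ 2 := by nlinarith
      exact mul_le_mul_of_nonneg_right h4 (sq_nonneg _)
    · have hz : fourierCoeffOn two_pi_pos (fun x => (w x : ℂ)) n = 0 := by
        rw [fourierCoeffOn_eq_integral]
        have e0 : ∫ x in (0 : ℝ)..(2 * π), (w x : ℂ) = 0 := by
          rw [intervalIntegral.integral_ofReal, h0, Complex.ofReal_zero]
        have e1 : ∫ x in (0 : ℝ)..(2 * π), (w x : ℂ) * (cos x : ℂ) = 0 := by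
          simp_rw [← Complex.ofReal_mul]
          rw [intervalIntegral.integral_ofReal, hc, Complex.ofReal_zero]
        have e2 : ∫ x in (0 : ℝ)..(2 * π), (w x : ℂ) * (sin x : ℂ) = 0 := by
          simp_rw [← Complex.ofReal_mul]
          rw [intervalIntegral.integral_ofReal, hs, Complex.ofReal_zero]
        have i1 : IntervalIntegrable (fun x : ℝ => (w x : ℂ) * (cos x : ℂ)) volume 0 (2 * π) :=
          Continuous.intervalIntegrable (by fun_prop) _ _
        have i2 : IntervalIntegrable (fun x : ℝ => (w x : ℂ) * (sin x : ℂ)) volume 0 (2 * π) :=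
          Continuous.intervalIntegrable (by fun_prop) _ _
        have hn' : n = -1 ∨ n = 0 ∨ n = 1 := by
          rw [not_le, abs_lt] at hn
          omega
        have : ∫ x in (0 : ℝ)..(2 * π), fourier (-n) (x : AddCircle (2 * π - 0)) • (w x : ℂ)
            = 0 := by
          simp_rw [hexp, smul_eq_mul]
          rcases hn' with rfl | rfl | rfl
          · have : ∀ x : ℝ, Complex.exp (-(((-1 : ℤ) : ℂ) * x) * Complex.I) * (w x : ℂ)
                = (w x : ℂ) * (cos x : ℂ) + Complex.I * ((w x : ℂ) * (sin x : ℂ)) := by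
              intro x
              rw [Complex.exp_mul_I]
              push_cast
              simp only [neg_mul, one_mul, neg_neg]
              ring
            simp_rw [this]
            rw [intervalIntegral.integral_add i1 (i2.const_mul _),
              intervalIntegral.integral_const_mul, e1, e2]
            simp
          · simpa using e0
          · have : ∀ x : ℝ, Complex.exp (-(((1 : ℤ) : ℂ) * x) * Complex.I) * (w x : ℂ)
                = (w x : ℂ) * (cos x : ℂ) - Complex.I * ((w x : ℂ) * (sin x : ℂ)) := by
              intro x
              rw [Complex.exp_mul_I]
              push_cast
              simp only [one_mul, Complex.cos_neg, Complex.sin_neg]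
              ring
            simp_rw [this]
            rw [intervalIntegral.integral_sub i1 (i2.const_mul _),
              intervalIntegral.integral_const_mul, e1, e2]
            simp
        rw [this, smul_zero]
      rw [hz, norm_zero, zero_pow two_ne_zero, mul_zero]
      exact sq_nonneg _
  have hle := hasSum_le key (s1.mul_left 4) s2
  simp only [Complex.norm_real, norm_eq_abs, sq_abs, sub_zero, smul_eq_mul] at hle
  have hpos : 0 < (2 * π)⁻¹ := by positivity
  have : (2 * π)⁻¹ * (4 * ∫ x in (0 : ℝ)..(2 * π), w x ^ 2)
      ≤ (2 * π)⁻¹ * ∫ x in (0 : ℝ)..(2 * π), deriv w x ^ 2 := by linarith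
  exact le_of_mul_le_mul_left this hpos

/-- The Wirtinger inequality on an interval of length at most `π`, with Dirichlet boundary
conditions. -/
theorem integral_sq_le_of_eq_zero {g : ℝ → ℝ} (hg : ContDiff ℝ ∞ g) {a b : ℝ} (hab : a ≤ b)
    (hlen : b - a ≤ π) (ha : g a = 0) (hb : g b = 0) :
    ∫ x in a..b, g x ^ 2 ≤ ∫ x in a..b, deriv g x ^ 2 := by
  have hgd : Differentiable ℝ g := hg.differentiable (by simp)
  have hg' : Continuous (deriv g) := hg.continuous_deriv (by simp)
  have hgc : Continuous g := hg.continuous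
  -- Picone's identity against the comparison function cos(τ(x − m)), m the midpoint. For τ < 1 it
  -- is positive on all of [a, b], even when b − a = π; the limit τ → 1 is taken at the end.
  have key : ∀ τ ∈ Set.Ioo (0 : ℝ) 1,
      τ ^ 2 * ∫ x in a..b, g x ^ 2 ≤ ∫ x in a..b, deriv g x ^ 2 := by
    rintro τ ⟨hτ0, hτ1⟩
    set m := (a + b) / 2 with hm
    have hcos : ∀ x ∈ Set.Icc a b, 0 < cos (τ * (x - m)) := by
      rintro x ⟨hx1, hx2⟩
      have hπ := pi_pos
      apply cos_pos_of_mem_Ioo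
      constructor <;> nlinarith
    have hd : ∀ x ∈ Set.uIcc a b, HasDerivAt
        (fun x => -(g x ^ 2 * (τ * sin (τ * (x - m)) / cos (τ * (x - m)))))
        (deriv g x ^ 2 - τ ^ 2 * g x ^ 2
          - (deriv g x + g x * (τ * sin (τ * (x - m)) / cos (τ * (x - m)))) ^ 2) x := by
      intro x hx
      rw [Set.uIcc_of_le hab] at hx
      have hne := (hcos x hx).ne'
      have l : HasDerivAt (fun x => τ * (x - m)) τ x := by
        simpa using ((hasDerivAt_id x).sub_const m).const_mul τ
      have h := (((hgd x).hasDerivAt.pow 2).mul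
        (((l.sin).const_mul τ).div l.cos hne)).neg
      refine HasDerivAt.congr_deriv (f := fun x =>
        -(g x ^ 2 * (τ * sin (τ * (x - m)) / cos (τ * (x - m))))) h ?_
      simp only [Pi.pow_apply, Pi.div_apply]
      push_cast
      generalize sin (τ * (x - m)) = S at *
      generalize cos (τ * (x - m)) = C at *
      field_simp
      ring
    have hq : ContinuousOn (fun x => g x * (τ * sin (τ * (x - m)) / cos (τ * (x - m))))
        (Set.uIcc a b) := by
      rw [Set.uIcc_of_le hab]
      refine hgc.continuousOn.mul (ContinuousOn.div (by fun_prop) (by fun_prop) ?_)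
      exact fun x hx => (hcos x hx).ne'
    have c1 : ContinuousOn (fun x => deriv g x ^ 2 - τ ^ 2 * g x ^ 2) (Set.uIcc a b) := by fun_prop
    have c2 : ContinuousOn (fun x => (deriv g x +
        g x * (τ * sin (τ * (x - m)) / cos (τ * (x - m)))) ^ 2) (Set.uIcc a b) :=
      (hg'.continuousOn.add hq).pow 2
    have hint := integral_eq_sub_of_hasDerivAt hd (c1.sub c2).intervalIntegrable
    rw [intervalIntegral.integral_sub c1.intervalIntegrable c2.intervalIntegrable,
      intervalIntegral.integral_sub (Continuous.intervalIntegrable (by fun_prop) _ _)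
        (Continuous.intervalIntegrable (by fun_prop) _ _),
      intervalIntegral.integral_const_mul, ha, hb] at hint
    have hnn : 0 ≤ ∫ x in a..b, (deriv g x +
        g x * (τ * sin (τ * (x - m)) / cos (τ * (x - m)))) ^ 2 :=
      intervalIntegral.integral_nonneg hab fun x _ => sq_nonneg _
    simp only [ne_eq, OfNat.ofNat_ne_zero, not_false_eq_true, zero_pow, zero_mul, neg_zero,
      sub_self] at hint
    linarith
  have hlim : Filter.Tendsto (fun τ : ℝ => τ ^ 2 * ∫ x in a..b, g x ^ 2)
      (nhdsWithin 1 (Set.Iio 1)) (nhds (1 ^ 2 * ∫ x in a..b, g x ^ 2)) :=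
    (Continuous.tendsto (by fun_prop) 1).mono_left nhdsWithin_le_nhds
  rw [one_pow, one_mul] at hlim
  refine le_of_tendsto hlim ?_
  filter_upwards [Ioo_mem_nhdsLT (zero_lt_one' ℝ)] with τ hτ using key τ hτ

/-- A zero set meeting all half circles contains three points which split the circle into arcs of
length at most `π`. -/
theorem exists_three_zeros {g : ℝ → ℝ} (hg : Continuous g)
    (H : ∀ a, ∃ z ∈ Set.Icc a (a + π), g z = 0) :
    ∃ z₀ z₁ z₂, (z₀ ≤ z₁ ∧ z₁ ≤ z₂ ∧ z₂ ≤ z₀ + 2 * π) ∧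
      (z₁ - z₀ ≤ π ∧ z₂ - z₁ ≤ π ∧ z₀ + 2 * π - z₂ ≤ π) ∧ g z₀ = 0 ∧ g z₁ = 0 ∧ g z₂ = 0 := by
  have hπ := pi_pos
  obtain ⟨z₀, -, h0⟩ := H 0
  have hclosed : IsClosed {z | g z = 0} := isClosed_eq hg continuous_const
  have hcomp : IsCompact (Set.Icc z₀ (z₀ + π) ∩ {z | g z = 0}) := isCompact_Icc.inter_right hclosed
  -- The last zero within distance π of z₀, so that no zero lies strictly between z₁ and z₀ + π.
  obtain ⟨z₁, ⟨⟨h01, h1π⟩, h1⟩, hmax⟩ :=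
    hcomp.exists_isGreatest ⟨z₀, ⟨le_rfl, by linarith⟩, h0⟩
  have hz₂ : ∃ z₂ ∈ Set.Icc (z₀ + π) (z₁ + π), g z₂ = 0 := by
    by_contra hcon
    push Not at hcon
    have hne : g (z₁ + π) ≠ 0 := hcon _ ⟨by linarith, le_rfl⟩
    obtain ⟨ε, hε, hball⟩ := Metric.eventually_nhds_iff.1 (hg.continuousAt.eventually_ne hne)
    -- Starting the half circle just after z₁ leaves no room for its zero: maximality of z₁, the
    -- assumed gap and continuity at z₁ + π exclude the three possible positions.
    obtain ⟨z, ⟨hz1, hz2⟩, hz⟩ := H (z₁ + ε / 2)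
    rcases le_or_gt z (z₀ + π) with h | h
    · have := hmax ⟨⟨by linarith, h⟩, hz⟩
      linarith
    · rcases le_or_gt z (z₁ + π) with h' | h'
      · exact hcon z ⟨h.le, h'⟩ hz
      · refine hball ?_ hz
        rw [Real.dist_eq, abs_lt]
        constructor <;> linarith
  obtain ⟨z₂, ⟨h2a, h2b⟩, h2⟩ := hz₂
  exact ⟨z₀, z₁, z₂, ⟨h01, by linarith, by linarith⟩,
    ⟨by linarith, by linarith, by linarith⟩, h0, h1, h2⟩

/-- The Wirtinger inequality for periodic functions with three zeros splitting the circle into arcs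
of length at most `π`. -/
theorem SmoothPeriodic.integral_sq_le {g : ℝ → ℝ} (hg : SmoothPeriodic g) {z₀ z₁ z₂ : ℝ}
    (ho : z₀ ≤ z₁ ∧ z₁ ≤ z₂ ∧ z₂ ≤ z₀ + 2 * π)
    (hl : z₁ - z₀ ≤ π ∧ z₂ - z₁ ≤ π ∧ z₀ + 2 * π - z₂ ≤ π)
    (h0 : g z₀ = 0) (h1 : g z₁ = 0) (h2 : g z₂ = 0) :
    ∫ x in (0 : ℝ)..(2 * π), g x ^ 2 ≤ ∫ x in (0 : ℝ)..(2 * π), deriv g x ^ 2 := by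
  have split : ∀ {f : ℝ → ℝ}, SmoothPeriodic f → ∫ x in (0 : ℝ)..(2 * π), f x =
      (∫ x in z₀..z₁, f x) + (∫ x in z₁..z₂, f x) + ∫ x in z₂..(z₀ + 2 * π), f x := by
    intro f hf
    rw [integral_add_adjacent_intervals (hf.intervalIntegrable _ _) (hf.intervalIntegrable _ _),
      integral_add_adjacent_intervals (hf.intervalIntegrable _ _) (hf.intervalIntegrable _ _),
      hf.periodic.intervalIntegral_add_eq z₀ 0, zero_add]
  rw [split (hg.pow 2), split (hg.deriv.pow 2)]
  have e1 := integral_sq_le_of_eq_zero hg.smooth ho.1 hl.1 h0 h1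
  have e2 := integral_sq_le_of_eq_zero hg.smooth ho.2.1 hl.2.1 h1 h2
  have e3 := integral_sq_le_of_eq_zero hg.smooth ho.2.2 hl.2.2 h2 (by rw [hg.periodic, h0])
  linarith

/-- The bridge between analysis and geometry: when g is a support function, the right side is minus
twice an area, so a Wirtinger inequality becomes an inequality between mixed areas. -/
theorem SmoothPeriodic.energy_eq {g : ℝ → ℝ} (hg : SmoothPeriodic g) :
    (∫ x in (0 : ℝ)..(2 * π), deriv g x ^ 2) - ∫ x in (0 : ℝ)..(2 * π), g x ^ 2
      = -∫ x in (0 : ℝ)..(2 * π), g x * (g x + deriv (deriv g) x) := by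
  have h := hg.integral_mul_deriv hg.deriv
  have e : ∫ x in (0 : ℝ)..(2 * π), g x * (g x + deriv (deriv g) x)
      = (∫ x in (0 : ℝ)..(2 * π), g x ^ 2) + ∫ x in (0 : ℝ)..(2 * π), g x * deriv (deriv g) x := by
    rw [← integral_add ((hg.pow 2).intervalIntegrable _ _)
      ((hg.mul hg.deriv.deriv).intervalIntegrable _ _)]
    congr 1
    ext x
    ring
  have e' : ∫ x in (0 : ℝ)..(2 * π), deriv g x ^ 2
      = ∫ x in (0 : ℝ)..(2 * π), deriv g x * deriv g x := by
    congr 1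
    ext x
    ring
  rw [e, h, e']
  ring

/-- The first variation of the energy at a function of zero energy which minimizes the energy in the
direction `φ`. -/
theorem SmoothPeriodic.first_variation_eq_zero {g φ : ℝ → ℝ} (hg : SmoothPeriodic g)
    (hφ : SmoothPeriodic φ)
    (heq : ∫ x in (0 : ℝ)..(2 * π), g x ^ 2 = ∫ x in (0 : ℝ)..(2 * π), deriv g x ^ 2)
    (hmin : ∀ t : ℝ, ∫ x in (0 : ℝ)..(2 * π), (g x + t * φ x) ^ 2
      ≤ ∫ x in (0 : ℝ)..(2 * π), deriv (fun y => g y + t * φ y) x ^ 2) :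
    ∫ x in (0 : ℝ)..(2 * π), φ x * (g x + deriv (deriv g) x) = 0 := by
  have hh := hg.add hg.deriv.deriv
  -- The operator 1 + d²/dx² is self-adjoint on periodic functions.
  have hcross : (∫ x in (0 : ℝ)..(2 * π), φ x * (g x + deriv (deriv g) x))
      = ∫ x in (0 : ℝ)..(2 * π), g x * (φ x + deriv (deriv φ) x) := by
    have a1 := hφ.integral_mul_deriv hg.deriv
    have a2 := hg.integral_mul_deriv hφ.deriv
    have i1 := (hφ.mul hg).intervalIntegrable 0 (2 * π)
    have i2 := (hφ.mul hg.deriv.deriv).intervalIntegrable 0 (2 * π)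
    have i3 := (hg.mul hφ).intervalIntegrable 0 (2 * π)
    have i4 := (hg.mul hφ.deriv.deriv).intervalIntegrable 0 (2 * π)
    simp only [mul_add]
    rw [integral_add i1 i2, integral_add i3 i4, a1, a2]
    simp only [mul_comm]
  set B := ∫ x in (0 : ℝ)..(2 * π), φ x * (g x + deriv (deriv g) x) with hB
  set C := ∫ x in (0 : ℝ)..(2 * π), φ x * (φ x + deriv (deriv φ) x) with hC
  -- The energy of g + tφ as a polynomial in t. Its constant term is the energy of g, which is zero,
  -- so nonnegativity forces the discriminant 4B² to be at most zero.
  have quad : ∀ t : ℝ, 0 ≤ -C * (t * t) + (-2 * B) * t + 0 := by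
    intro t
    have hp : SmoothPeriodic (fun x => g x + t * φ x) := hg.add ((SmoothPeriodic.const t).mul hφ)
    have hd1 : deriv (fun x => g x + t * φ x) = fun x => deriv g x + t * deriv φ x := by
      ext x
      exact ((hg.hasDerivAt x).add ((hφ.hasDerivAt x).const_mul t)).deriv
    have hd2 : deriv (fun x => deriv g x + t * deriv φ x)
        = fun x => deriv (deriv g) x + t * deriv (deriv φ) x := by
      ext x
      exact ((hg.deriv.hasDerivAt x).add ((hφ.deriv.hasDerivAt x).const_mul t)).deriv
    have hle := hmin t
    have hE := hp.energy_eq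
    rw [hd1, hd2] at hE
    rw [hd1] at hle
    have hEg := hg.energy_eq
    have i1 := (hg.mul hh).intervalIntegrable 0 (2 * π)
    have i2 := (hφ.mul hh).intervalIntegrable 0 (2 * π)
    have i3 := (hg.mul (hφ.add hφ.deriv.deriv)).intervalIntegrable 0 (2 * π)
    have i4 := (hφ.mul (hφ.add hφ.deriv.deriv)).intervalIntegrable 0 (2 * π)
    have hsum : ∫ x in (0 : ℝ)..(2 * π), (g x + t * φ x) *
        (g x + t * φ x + (deriv (deriv g) x + t * deriv (deriv φ) x))
        = (∫ x in (0 : ℝ)..(2 * π), g x * (g x + deriv (deriv g) x)) + t * B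
          + t * (∫ x in (0 : ℝ)..(2 * π), g x * (φ x + deriv (deriv φ) x))
          + t ^ 2 * C := by
      rw [hB, hC, ← intervalIntegral.integral_const_mul, ← intervalIntegral.integral_const_mul,
        ← intervalIntegral.integral_const_mul, ← integral_add i1 (i2.const_mul t),
        ← integral_add (i1.add (i2.const_mul t)) (i3.const_mul t),
        ← integral_add ((i1.add (i2.const_mul t)).add (i3.const_mul t)) (i4.const_mul (t ^ 2))]
      congr 1
      ext x
      ring
    rw [hsum, ← hcross] at hE
    rw [← heq, sub_self] at hEg
    linarith
  have := discrim_le_zero quad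
  rw [discrim] at this
  nlinarith [sq_nonneg B]

/-- The equality case of `SmoothPeriodic.integral_sq_le`. -/
theorem SmoothPeriodic.add_deriv_deriv_eq_zero {g : ℝ → ℝ} (hg : SmoothPeriodic g) {z₀ z₁ z₂ : ℝ}
    (ho : z₀ ≤ z₁ ∧ z₁ ≤ z₂ ∧ z₂ ≤ z₀ + 2 * π)
    (hl : z₁ - z₀ ≤ π ∧ z₂ - z₁ ≤ π ∧ z₀ + 2 * π - z₂ ≤ π)
    (h0 : g z₀ = 0) (h1 : g z₁ = 0) (h2 : g z₂ = 0)
    (heq : ∫ x in (0 : ℝ)..(2 * π), g x ^ 2 = ∫ x in (0 : ℝ)..(2 * π), deriv g x ^ 2) (x : ℝ) :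
    g x + deriv (deriv g) x = 0 := by
  obtain ⟨h, hh⟩ : ∃ h : ℝ → ℝ, h = fun x => g x + deriv (deriv g) x := ⟨_, rfl⟩
  have hhp : SmoothPeriodic h := hh ▸ hg.add hg.deriv.deriv
  have hone : ∀ z, SmoothPeriodic (fun x => 1 - cos (x - z)) := fun z =>
    (SmoothPeriodic.const 1).sub (SmoothPeriodic.cos.comp_sub_const z)
  -- A nonnegative weight vanishing exactly at the translates of the three zeros. The variation hψ
  -- keeps these zeros, so the Wirtinger inequality still applies to g + thψ, and the first
  -- variation reads ∫ h²ψ = 0.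
  obtain ⟨ψ, hψ⟩ : ∃ ψ : ℝ → ℝ, ψ = fun x =>
    (1 - cos (x - z₀)) * (1 - cos (x - z₁)) * (1 - cos (x - z₂)) := ⟨_, rfl⟩
  have hψp : SmoothPeriodic ψ := hψ ▸ ((hone z₀).mul (hone z₁)).mul (hone z₂)
  have hψ0 : ∀ x, 0 ≤ ψ x := fun x => hψ ▸ mul_nonneg (mul_nonneg
    (by linarith [cos_le_one (x - z₀)]) (by linarith [cos_le_one (x - z₁)]))
    (by linarith [cos_le_one (x - z₂)])
  have hψz : ψ z₀ = 0 ∧ ψ z₁ = 0 ∧ ψ z₂ = 0 := by simp [hψ]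
  have hφp : SmoothPeriodic (fun x => h x * ψ x) := hhp.mul hψp
  have hB0 := hg.first_variation_eq_zero hφp heq fun t =>
    (hg.add ((SmoothPeriodic.const t).mul hφp)).integral_sq_le ho hl (by simp [h0, hψz.1])
      (by simp [h1, hψz.2.1]) (by simp [h2, hψz.2.2])
  have hzero : ∀ x, h x ^ 2 * ψ x = 0 := by
    refine ((hhp.pow 2).mul hψp).eq_zero_of_integral_eq_zero
      (fun x => mul_nonneg (sq_nonneg _) (hψ0 x)) ?_
    rw [← hB0]
    congr 1
    ext x
    rw [hh]
    ring
  -- So far h vanishes only where ψ does not; the exceptional set is countable and continuity fills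
  -- it in.
  have hcount : (⋃ z ∈ ({z₀, z₁, z₂} : Set ℝ),
      Set.range (fun n : ℤ => n * (2 * π) + z)).Countable :=
    Set.Countable.biUnion (Set.toFinite _).countable fun z _ => Set.countable_range _
  have hdense := hcount.dense_compl ℝ
  have hext : h = fun _ => 0 := by
    refine Continuous.ext_on hdense hhp.continuous continuous_const fun y hy => ?_
    have hne : ∀ z ∈ ({z₀, z₁, z₂} : Set ℝ), 1 - cos (y - z) ≠ 0 := by
      intro z hz hc
      refine hy (Set.mem_biUnion hz ?_)
      obtain ⟨n, hn⟩ := (cos_eq_one_iff _).1 (sub_eq_zero.1 hc).symm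
      exact ⟨n, by simp only [hn]; ring⟩
    have hψy : ψ y ≠ 0 := hψ ▸ mul_ne_zero (mul_ne_zero (hne z₀ (by simp)) (hne z₁ (by simp)))
      (hne z₂ (by simp))
    exact pow_eq_zero_iff two_ne_zero |>.1 ((mul_eq_zero.1 (hzero y)).resolve_right hψy)
  rw [← congrFun hext x, hh]

/-- If a nonpositive function on the circle cannot be made negative by adding a function
`u cos + v sin`, then its zeros meet all half circles. -/
theorem SmoothPeriodic.exists_zero_of_optimal {g : ℝ → ℝ} (hg : SmoothPeriodic g)
    (hle : ∀ x, g x ≤ 0)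
    (hopt : ∀ u v ε : ℝ, 0 < ε → ¬ ∀ x, g x + (u * cos x + v * sin x) ≤ -ε) (a : ℝ) :
    ∃ z ∈ Set.Icc a (a + π), g z = 0 := by
  by_contra hcon
  push Not at hcon
  have hπ := pi_pos
  obtain ⟨b, hb, hbmax⟩ := isCompact_Icc.exists_isMaxOn (Set.nonempty_Icc.2 (by linarith :
    a ≤ a + π)) hg.continuous.continuousOn
  have hgb : g b < 0 := lt_of_le_of_ne (hle b) (hcon b hb)
  -- Half the gap between zero and the maximum of g on the half circle. Adding s sin(x − a) keeps g
  -- negative there and lowers it on the opposite open half circle; compactness then gives a uniform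
  -- negative bound.
  set s := -g b / 2 with hs
  have hs0 : 0 < s := by rw [hs]; linarith
  have hp : SmoothPeriodic (fun x => g x + s * sin (x - a)) :=
    hg.add ((SmoothPeriodic.const s).mul (SmoothPeriodic.sin.comp_sub_const a))
  have hneg : ∀ x, g x + s * sin (x - a) < 0 := by
    intro x
    obtain ⟨y, ⟨hy1, hy2⟩, hyx⟩ := hp.exists_mem_Icc a x
    rw [← hyx]
    rcases le_or_gt y (a + π) with h | h
    · have h1 : g y ≤ g b := hbmax ⟨hy1, h⟩
      have h2 := sin_le_one (y - a)
      nlinarith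
    · rcases hy2.lt_or_eq with h' | h'
      · have h1 : sin (y - a) < 0 := by
          have := sin_neg_of_neg_of_neg_pi_lt (x := y - a - 2 * π) (by linarith) (by linarith)
          rwa [sin_sub_two_pi] at this
        have h2 := hle y
        nlinarith
      · have : g y < 0 := by
          rw [h', hg.periodic]
          exact lt_of_le_of_ne (hle a) (hcon a ⟨le_rfl, by linarith⟩)
        have h2 : sin (y - a) = 0 := by
          rw [h', add_sub_cancel_left, sin_two_pi]
        rw [h2]
        linarith
  obtain ⟨M, ⟨x₀, hx₀⟩, hM⟩ := hp.isCompact_range.exists_isGreatest (Set.range_nonempty _)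
  refine hopt (-(s * sin a)) (s * cos a) (-M) (by rw [← hx₀]; linarith [hneg x₀]) fun x => ?_
  have := hM ⟨x, rfl⟩
  simp only [sin_sub] at this
  linarith

/-! ### Integral inequalities for support functions. -/

section Integrals

theorem integral_cos_sq_two_pi : ∫ x in (0 : ℝ)..(2 * π), cos x * cos x = π := by
  have := integral_cos_sq (a := 0) (b := 2 * π)
  simp only [pow_two] at this
  rw [this]
  simp

theorem integral_sin_sq_two_pi : ∫ x in (0 : ℝ)..(2 * π), sin x * sin x = π := by
  have := integral_sin_sq (a := 0) (b := 2 * π)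
  simp only [pow_two] at this
  rw [this]
  simp

theorem integral_sin_mul_cos_two_pi : ∫ x in (0 : ℝ)..(2 * π), sin x * cos x = 0 := by
  rw [integral_sin_mul_cos₁]
  simp

variable {p : ℝ → ℝ}

theorem SmoothPeriodic.integral_add_deriv_deriv (hp : SmoothPeriodic p) :
    ∫ x in (0 : ℝ)..(2 * π), (p x + deriv (deriv p) x) = ∫ x in (0 : ℝ)..(2 * π), p x := by
  rw [integral_add (hp.intervalIntegrable _ _) (hp.deriv.deriv.intervalIntegrable _ _),
    hp.deriv.integral_deriv_eq_zero, add_zero]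

/-- Two integrations by parts move 1 + d²/dx² onto cos, which it kills. With the sine analogue, this
says that a curve with curvature radius p + p'' closes up. -/
theorem SmoothPeriodic.integral_cos_mul_add_deriv_deriv (hp : SmoothPeriodic p) :
    ∫ x in (0 : ℝ)..(2 * π), cos x * (p x + deriv (deriv p) x) = 0 := by
  have h1 := SmoothPeriodic.cos.integral_mul_deriv hp.deriv
  have h2 := SmoothPeriodic.sin.integral_mul_deriv hp
  simp only [Real.deriv_cos', Real.deriv_sin, neg_mul, intervalIntegral.integral_neg, neg_neg]
    at h1 h2
  simp only [mul_add]
  rw [integral_add ((SmoothPeriodic.cos.mul hp).intervalIntegrable _ _)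
    ((SmoothPeriodic.cos.mul hp.deriv.deriv).intervalIntegrable _ _), h1, h2]
  ring

theorem SmoothPeriodic.integral_sin_mul_add_deriv_deriv (hp : SmoothPeriodic p) :
    ∫ x in (0 : ℝ)..(2 * π), sin x * (p x + deriv (deriv p) x) = 0 := by
  have h1 := SmoothPeriodic.sin.integral_mul_deriv hp.deriv
  have h2 := SmoothPeriodic.cos.integral_mul_deriv hp
  simp only [Real.deriv_cos', Real.deriv_sin, neg_mul, intervalIntegral.integral_neg, neg_neg]
    at h1 h2
  simp only [mul_add]
  rw [integral_add ((SmoothPeriodic.sin.mul hp).intervalIntegrable _ _)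
    ((SmoothPeriodic.sin.mul hp.deriv.deriv).intervalIntegrable _ _), h1, h2]
  ring

/-- The function `p - (u cos + v sin) - r`: translating a convex set by `(-u, -v)` and taking the
inner parallel set at distance `r` has this effect on its support function. -/
def shift (p : ℝ → ℝ) (u v r x : ℝ) : ℝ := p x - (u * cos x + v * sin x) - r

protected theorem SmoothPeriodic.shift (hp : SmoothPeriodic p) (u v r : ℝ) :
    SmoothPeriodic (shift p u v r) :=
  (hp.sub (((SmoothPeriodic.const u).mul SmoothPeriodic.cos).add
    ((SmoothPeriodic.const v).mul SmoothPeriodic.sin))).sub (SmoothPeriodic.const r)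

theorem SmoothPeriodic.shift_add_deriv_deriv (hp : SmoothPeriodic p) (u v r x : ℝ) :
    shift p u v r x + deriv (deriv (shift p u v r)) x
      = p x + deriv (deriv p) x - r := by
  have h1 : deriv (shift p u v r)
      = fun x => deriv p x - (u * -sin x + v * cos x) := by
    ext y
    exact (((hp.hasDerivAt y).sub (((hasDerivAt_cos y).const_mul u).add
      ((hasDerivAt_sin y).const_mul v))).sub_const r).deriv
  have h2 : deriv (deriv (shift p u v r)) x
      = deriv (deriv p) x - (u * -cos x + v * -sin x) := by
    rw [h1]
    exact ((hp.deriv.hasDerivAt x).sub (((hasDerivAt_sin x).neg.const_mul u).add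
      ((hasDerivAt_cos x).const_mul v))).deriv
  rw [h2, shift]
  ring

/-- The parameters u, v drop out because area is translation invariant; what remains is Steiner's
polynomial in r for twice the area of the inner parallel body. -/
theorem SmoothPeriodic.integral_shift_mul (hp : SmoothPeriodic p) (u v r : ℝ) :
    ∫ x in (0 : ℝ)..(2 * π), shift p u v r x *
        (shift p u v r x + deriv (deriv (shift p u v r)) x)
      = (∫ x in (0 : ℝ)..(2 * π), p x * (p x + deriv (deriv p) x))
        - 2 * r * (∫ x in (0 : ℝ)..(2 * π), p x) + 2 * π * r ^ 2 := by
  have hr := hp.add hp.deriv.deriv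
  have i1 := (hp.mul hr).intervalIntegrable 0 (2 * π)
  have i2 := hp.intervalIntegrable 0 (2 * π)
  have i3 := hr.intervalIntegrable 0 (2 * π)
  have i4 := (SmoothPeriodic.cos.mul hr).intervalIntegrable 0 (2 * π)
  have i5 := (SmoothPeriodic.sin.mul hr).intervalIntegrable 0 (2 * π)
  have i6 := SmoothPeriodic.cos.intervalIntegrable 0 (2 * π)
  have i7 := SmoothPeriodic.sin.intervalIntegrable 0 (2 * π)
  have i8 : IntervalIntegrable (fun _ : ℝ => r ^ 2) volume 0 (2 * π) :=
    continuous_const.intervalIntegrable _ _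
  have hsum : ∀ x, shift p u v r x *
        (shift p u v r x + deriv (deriv (shift p u v r)) x)
      = p x * (p x + deriv (deriv p) x) - r * p x - r * (p x + deriv (deriv p) x)
        - u * (cos x * (p x + deriv (deriv p) x)) - v * (sin x * (p x + deriv (deriv p) x))
        + (r * u) * cos x + (r * v) * sin x + r ^ 2 := by
    intro x
    rw [hp.shift_add_deriv_deriv, shift]
    ring
  simp_rw [hsum]
  have j1 := i1.sub (i2.const_mul r)
  have j2 := j1.sub (i3.const_mul r)
  have j3 := j2.sub (i4.const_mul u)
  have j4 := j3.sub (i5.const_mul v)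
  have j5 := j4.add (i6.const_mul (r * u))
  have j6 := j5.add (i7.const_mul (r * v))
  rw [integral_add j6 i8, integral_add j5 (i7.const_mul (r * v)),
    integral_add j4 (i6.const_mul (r * u)), integral_sub j3 (i5.const_mul v),
    integral_sub j2 (i4.const_mul u), integral_sub j1 (i3.const_mul r),
    integral_sub i1 (i2.const_mul r)]
  simp only [intervalIntegral.integral_const_mul, hp.integral_add_deriv_deriv,
    hp.integral_cos_mul_add_deriv_deriv, hp.integral_sin_mul_add_deriv_deriv, integral_cos,
    integral_sin, intervalIntegral.integral_const]
  simp
  ring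

/-- Bonnesen's inequality for a circle which touches on every half circle. -/
theorem SmoothPeriodic.bonnesen (hp : SmoothPeriodic p) (u v r : ℝ)
    (H : ∀ a, ∃ z ∈ Set.Icc a (a + π), shift p u v r z = 0) :
    (2 * π * r - ∫ x in (0 : ℝ)..(2 * π), p x) ^ 2 ≤
      (∫ x in (0 : ℝ)..(2 * π), p x) ^ 2
        - 2 * π * ∫ x in (0 : ℝ)..(2 * π), p x * (p x + deriv (deriv p) x) := by
  have hg := hp.shift u v r
  obtain ⟨z₀, z₁, z₂, ho, hl, h0, h1, h2⟩ := exists_three_zeros hg.continuous H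
  have hle := hg.integral_sq_le ho hl h0 h1 h2
  have hE := hg.energy_eq
  rw [hp.integral_shift_mul] at hE
  -- The energy inequality is Q − 2rL + 2πr² ≤ 0; multiply by 2π and complete the square.
  nlinarith [pi_pos]

/-- Equality means that the shifted function has zero energy, so the equality case of the Wirtinger
inequality annihilates g + g'' = ρ − r. -/
theorem SmoothPeriodic.add_deriv_deriv_eq_of_bonnesen_eq (hp : SmoothPeriodic p) (u v r : ℝ)
    (H : ∀ a, ∃ z ∈ Set.Icc a (a + π), shift p u v r z = 0)
    (heq : (2 * π * r - ∫ x in (0 : ℝ)..(2 * π), p x) ^ 2 =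
      (∫ x in (0 : ℝ)..(2 * π), p x) ^ 2
        - 2 * π * ∫ x in (0 : ℝ)..(2 * π), p x * (p x + deriv (deriv p) x)) (x : ℝ) :
    p x + deriv (deriv p) x = r := by
  have hg := hp.shift u v r
  obtain ⟨z₀, z₁, z₂, ho, hl, h0, h1, h2⟩ := exists_three_zeros hg.continuous H
  have hE := hg.energy_eq
  rw [hp.integral_shift_mul] at hE
  have hπ := pi_pos
  have hz : (∫ x in (0 : ℝ)..(2 * π), p x * (p x + deriv (deriv p) x))
        - 2 * r * (∫ x in (0 : ℝ)..(2 * π), p x) + 2 * π * r ^ 2 = 0 := by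
    have : (2 * π) * ((∫ x in (0 : ℝ)..(2 * π), p x * (p x + deriv (deriv p) x))
        - 2 * r * (∫ x in (0 : ℝ)..(2 * π), p x) + 2 * π * r ^ 2) = 0 := by linarith
    exact (mul_eq_zero.1 this).resolve_left (by positivity)
  rw [hz, neg_zero, sub_eq_zero] at hE
  have := hg.add_deriv_deriv_eq_zero ho hl h0 h1 h2 hE.symm x
  rw [hp.shift_add_deriv_deriv] at this
  linarith

/-- The isoperimetric inequality for support functions, together with an upper bound of the deficit
by the variance of the curvature radius. -/
theorem SmoothPeriodic.deficit_bounds (hp : SmoothPeriodic p) {L Q S : ℝ}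
    (hL : ∫ x in (0 : ℝ)..(2 * π), p x = L)
    (hQ : ∫ x in (0 : ℝ)..(2 * π), p x * (p x + deriv (deriv p) x) = Q)
    (hS : ∫ x in (0 : ℝ)..(2 * π), (p x + deriv (deriv p) x - L / (2 * π)) ^ 2 = S) :
    0 ≤ L ^ 2 / (4 * π) - Q / 2 ∧ 6 * (L ^ 2 / (4 * π) - Q / 2) ≤ S := by
  have hπ := pi_pos
  -- The first Fourier coefficients of p and its mean a: subtracting them leaves a function with
  -- modes of order at least two only, whose energy is 2D.
  set u := (∫ x in (0 : ℝ)..(2 * π), p x * cos x) / π with hu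
  set v := (∫ x in (0 : ℝ)..(2 * π), p x * sin x) / π with hv
  set a := L / (2 * π) with ha
  set g := shift p u v a with hgdef
  have hg : SmoothPeriodic g := hp.shift u v a
  have i1 := hp.intervalIntegrable 0 (2 * π)
  have i2 := SmoothPeriodic.cos.intervalIntegrable 0 (2 * π)
  have i3 := SmoothPeriodic.sin.intervalIntegrable 0 (2 * π)
  have i4 : IntervalIntegrable (fun _ : ℝ => a) volume 0 (2 * π) :=
    continuous_const.intervalIntegrable _ _
  have i5 := (hp.mul SmoothPeriodic.cos).intervalIntegrable 0 (2 * π)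
  have i6 := (hp.mul SmoothPeriodic.sin).intervalIntegrable 0 (2 * π)
  have i7 := (SmoothPeriodic.cos.mul SmoothPeriodic.cos).intervalIntegrable 0 (2 * π)
  have i8 := (SmoothPeriodic.sin.mul SmoothPeriodic.sin).intervalIntegrable 0 (2 * π)
  have i9 := (SmoothPeriodic.sin.mul SmoothPeriodic.cos).intervalIntegrable 0 (2 * π)
  have c0 : ∫ x in (0 : ℝ)..(2 * π), g x = 0 := by
    have : ∀ x, g x = p x - u * cos x - v * sin x - a := fun x => by
      rw [hgdef, shift]; ring
    simp_rw [this]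
    rw [integral_sub ((i1.sub (i2.const_mul u)).sub (i3.const_mul v)) i4,
      integral_sub (i1.sub (i2.const_mul u)) (i3.const_mul v), integral_sub i1 (i2.const_mul u), hL]
    simp only [intervalIntegral.integral_const_mul, integral_cos, integral_sin,
      intervalIntegral.integral_const]
    simp [ha]
    field_simp
    ring
  have c1 : ∫ x in (0 : ℝ)..(2 * π), g x * cos x = 0 := by
    have : ∀ x, g x * cos x = p x * cos x - u * (cos x * cos x) - v * (sin x * cos x)
        - a * cos x := fun x => by
      rw [hgdef, shift]; ring
    simp_rw [this]
    rw [integral_sub ((i5.sub (i7.const_mul u)).sub (i9.const_mul v)) (i2.const_mul a),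
      integral_sub (i5.sub (i7.const_mul u)) (i9.const_mul v), integral_sub i5 (i7.const_mul u)]
    simp only [intervalIntegral.integral_const_mul, integral_cos, integral_cos_sq_two_pi,
      integral_sin_mul_cos_two_pi]
    simp [hu]
  have c2 : ∫ x in (0 : ℝ)..(2 * π), g x * sin x = 0 := by
    have : ∀ x, g x * sin x = p x * sin x - u * (sin x * cos x) - v * (sin x * sin x)
        - a * sin x := fun x => by
      rw [hgdef, shift]; ring
    simp_rw [this]
    rw [integral_sub ((i6.sub (i9.const_mul u)).sub (i8.const_mul v)) (i3.const_mul a),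
      integral_sub (i6.sub (i9.const_mul u)) (i8.const_mul v), integral_sub i6 (i9.const_mul u)]
    simp only [intervalIntegral.integral_const_mul, integral_sin, integral_sin_sq_two_pi,
      integral_sin_mul_cos_two_pi]
    simp [hv]
  have hW := four_mul_integral_sq_le hg c0 c1 c2
  have hE := hg.energy_eq
  have hsm := hp.integral_shift_mul u v a
  rw [← hgdef, hQ, hL] at hsm
  have hD : Q - 2 * a * L + 2 * π * a ^ 2 = -2 * (L ^ 2 / (4 * π) - Q / 2) := by
    rw [ha]
    field_simp
    ring
  rw [hsm, hD] at hE
  have hnn : 0 ≤ ∫ x in (0 : ℝ)..(2 * π), g x ^ 2 :=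
    intervalIntegral.integral_nonneg two_pi_pos.le fun x _ => sq_nonneg _
  -- The constant 3 makes the square vanish on modes of order two, where g'' = −4g. Expanding gives
  -- S ≥ 12D − 9∫g², and the Wirtinger inequality gives 3∫g² ≤ 2D; together S ≥ 6D.
  have hnn2 : 0 ≤ ∫ x in (0 : ℝ)..(2 * π), (g x + deriv (deriv g) x + 3 * g x) ^ 2 :=
    intervalIntegral.integral_nonneg two_pi_pos.le fun x _ => sq_nonneg _
  have hr := hg.add hg.deriv.deriv
  have hexp : ∫ x in (0 : ℝ)..(2 * π), (g x + deriv (deriv g) x + 3 * g x) ^ 2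
      = S + 6 * (-2 * (L ^ 2 / (4 * π) - Q / 2)) + 9 * ∫ x in (0 : ℝ)..(2 * π), g x ^ 2 := by
    have hS' : ∫ x in (0 : ℝ)..(2 * π), (g x + deriv (deriv g) x) ^ 2 = S := by
      rw [← hS]
      simp only [hgdef, hp.shift_add_deriv_deriv]
    have k1 := (hr.pow 2).intervalIntegrable 0 (2 * π)
    have k2 := (hg.mul hr).intervalIntegrable 0 (2 * π)
    have k3 := (hg.pow 2).intervalIntegrable 0 (2 * π)
    rw [← hS', ← hD, ← hsm, ← intervalIntegral.integral_const_mul,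
      ← intervalIntegral.integral_const_mul, ← integral_add k1 (k2.const_mul 6),
      ← integral_add (k1.add (k2.const_mul 6)) (k3.const_mul 9)]
    congr 1
    ext x
    ring
  constructor <;> linarith

/-- The function ρ − L/2π has mean zero and, since the curve closes up, no modes of order one; hence
the Wirtinger constant 4. -/
theorem SmoothPeriodic.four_mul_variance_le (hp : SmoothPeriodic p) {L : ℝ}
    (hL : ∫ x in (0 : ℝ)..(2 * π), p x = L) :
    4 * ∫ x in (0 : ℝ)..(2 * π), (p x + deriv (deriv p) x - L / (2 * π)) ^ 2
      ≤ ∫ x in (0 : ℝ)..(2 * π), deriv (fun y => p y + deriv (deriv p) y) x ^ 2 := by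
  have hπ := pi_pos
  have hr := hp.add hp.deriv.deriv
  have i3 := hr.intervalIntegrable 0 (2 * π)
  have i4 := (SmoothPeriodic.cos.mul hr).intervalIntegrable 0 (2 * π)
  have i5 := (SmoothPeriodic.sin.mul hr).intervalIntegrable 0 (2 * π)
  have i6 := SmoothPeriodic.cos.intervalIntegrable 0 (2 * π)
  have i7 := SmoothPeriodic.sin.intervalIntegrable 0 (2 * π)
  have h := four_mul_integral_sq_le (hr.sub (SmoothPeriodic.const (L / (2 * π)))) ?_ ?_ ?_
  · simpa only [deriv_sub_const_fun] using h
  · rw [integral_sub i3 (continuous_const.intervalIntegrable _ _), hp.integral_add_deriv_deriv, hL,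
      intervalIntegral.integral_const, smul_eq_mul]
    field_simp
    ring
  · have : ∀ x, (p x + deriv (deriv p) x - L / (2 * π)) * cos x
        = cos x * (p x + deriv (deriv p) x) - L / (2 * π) * cos x := fun x => by ring
    simp_rw [this]
    rw [integral_sub i4 (i6.const_mul _), hp.integral_cos_mul_add_deriv_deriv,
      intervalIntegral.integral_const_mul, integral_cos]
    simp
  · have : ∀ x, (p x + deriv (deriv p) x - L / (2 * π)) * sin x
        = sin x * (p x + deriv (deriv p) x) - L / (2 * π) * sin x := fun x => by ring
    simp_rw [this]
    rw [integral_sub i5 (i7.const_mul _), hp.integral_sin_mul_add_deriv_deriv,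
      intervalIntegral.integral_const_mul, integral_sin]
    simp

theorem SmoothPeriodic.variance_eq {f : ℝ → ℝ} (hf : SmoothPeriodic f) (c : ℝ) :
    ∫ x in (0 : ℝ)..(2 * π), (f x - c) ^ 2 = (∫ x in (0 : ℝ)..(2 * π), f x ^ 2)
      - 2 * c * (∫ x in (0 : ℝ)..(2 * π), f x) + 2 * π * c ^ 2 := by
  have i1 := (hf.pow 2).intervalIntegrable 0 (2 * π)
  have i2 := hf.intervalIntegrable 0 (2 * π)
  have : ∀ x, (f x - c) ^ 2 = f x ^ 2 - (2 * c) * f x + c ^ 2 := fun x => by ring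
  simp_rw [this]
  rw [integral_add (i1.sub (i2.const_mul _)) (continuous_const.intervalIntegrable _ _),
    integral_sub i1 (i2.const_mul _), intervalIntegral.integral_const_mul,
    intervalIntegral.integral_const, smul_eq_mul, sub_zero]

/-- Popoviciu's inequality on variances. -/
theorem SmoothPeriodic.variance_le {f : ℝ → ℝ} (hf : SmoothPeriodic f) {m M L : ℝ}
    (hm : ∀ x, m ≤ f x) (hM : ∀ x, f x ≤ M) (hL : ∫ x in (0 : ℝ)..(2 * π), f x = L) :
    ∫ x in (0 : ℝ)..(2 * π), (f x - L / (2 * π)) ^ 2 ≤ π / 2 * (M - m) ^ 2 := by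
  have hπ := pi_pos
  have h1 : ∫ x in (0 : ℝ)..(2 * π), (f x - (M + m) / 2) ^ 2
      ≤ ∫ _ in (0 : ℝ)..(2 * π), (M - m) ^ 2 / 4 := by
    refine integral_mono_on two_pi_pos.le
      (((hf.sub (SmoothPeriodic.const _)).pow 2).intervalIntegrable _ _)
      (continuous_const.intervalIntegrable _ _) fun x _ => ?_
    -- The pointwise bound is (f − m)(M − f) ≥ 0. Replacing the midrange (M + m)/2 by the mean only
    -- decreases the integral.
    nlinarith [mul_nonneg (sub_nonneg.2 (hm x)) (sub_nonneg.2 (hM x))]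
  rw [intervalIntegral.integral_const, smul_eq_mul, hf.variance_eq, hL] at h1
  rw [hf.variance_eq, hL]
  set V := ∫ x in (0 : ℝ)..(2 * π), f x ^ 2
  have h2 : V - 2 * (L / (2 * π)) * L + 2 * π * (L / (2 * π)) ^ 2
      = V - 2 * ((M + m) / 2) * L + 2 * π * ((M + m) / 2) ^ 2
        - 2 * π * ((M + m) / 2 - L / (2 * π)) ^ 2 := by
    field_simp
    ring
  have h3 : 0 ≤ 2 * π * ((M + m) / 2 - L / (2 * π)) ^ 2 := by positivity
  rw [h2]
  linarith

end Integrals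

/-! ### The angle of the normal along a locally convex curve. -/

section AngleLift

variable {x y : ℝ → ℝ}

/-- A locally convex regular plane curve has a smooth strictly increasing tangent angle. -/
theorem exists_angle_lift (hx : ContDiff ℝ ∞ x) (hy : ContDiff ℝ ∞ y)
    (hk : ∀ t, 0 < deriv x t * deriv (deriv y) t - deriv y t * deriv (deriv x) t) :
    ∃ ψ : ℝ → ℝ, ContDiff ℝ ∞ ψ ∧
      (∀ t, deriv ψ t = (deriv x t * deriv (deriv y) t - deriv y t * deriv (deriv x) t)
        / (deriv x t ^ 2 + deriv y t ^ 2)) ∧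
      (∀ t, deriv x t = -(√(deriv x t ^ 2 + deriv y t ^ 2) * sin (ψ t))) ∧
      ∀ t, deriv y t = √(deriv x t ^ 2 + deriv y t ^ 2) * cos (ψ t) := by
  have hx' : ContDiff ℝ ∞ (deriv x) := (contDiff_infty_iff_deriv.1 hx).2
  have hy' : ContDiff ℝ ∞ (deriv y) := (contDiff_infty_iff_deriv.1 hy).2
  have hx'' : ContDiff ℝ ∞ (deriv (deriv x)) := (contDiff_infty_iff_deriv.1 hx').2
  have hy'' : ContDiff ℝ ∞ (deriv (deriv y)) := (contDiff_infty_iff_deriv.1 hy').2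
  have dx : ∀ t, HasDerivAt (deriv x) (deriv (deriv x) t) t := fun t =>
    ((hx'.differentiable (by simp)) t).hasDerivAt
  have dy : ∀ t, HasDerivAt (deriv y) (deriv (deriv y) t) t := fun t =>
    ((hy'.differentiable (by simp)) t).hasDerivAt
  have hpos : ∀ t, 0 < deriv x t ^ 2 + deriv y t ^ 2 := by
    intro t
    by_contra hcon
    have h1 : deriv x t = 0 := by nlinarith [sq_nonneg (deriv x t), sq_nonneg (deriv y t)]
    have h2 : deriv y t = 0 := by nlinarith [sq_nonneg (deriv x t), sq_nonneg (deriv y t)]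
    have := hk t
    rw [h1, h2] at this
    simp at this
  set v : ℝ → ℝ := fun t => √(deriv x t ^ 2 + deriv y t ^ 2) with hv
  have hv0 : ∀ t, 0 < v t := fun t => sqrt_pos.2 (hpos t)
  have hv2 : ∀ t, v t ^ 2 = deriv x t ^ 2 + deriv y t ^ 2 := fun t => sq_sqrt (hpos t).le
  set k : ℝ → ℝ := fun t => (deriv x t * deriv (deriv y) t - deriv y t * deriv (deriv x) t)
        / (deriv x t ^ 2 + deriv y t ^ 2) with hkdef
  have hksm : ContDiff ℝ ∞ k :=
    ((hx'.mul hy'').sub (hy'.mul hx'')).div ((hx'.pow 2).add (hy'.pow 2)) fun t => (hpos t).ne'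
  -- The initial angle of the normal (y', −x'), the velocity turned clockwise. The angle is then
  -- obtained by integrating speed times curvature; the components of the unit tangent in the
  -- rotating frame have zero derivative and keep their initial values 0 and 1.
  obtain ⟨ψ₀, hc0, hs0⟩ : ∃ ψ₀, v 0 * cos ψ₀ = deriv y 0 ∧ v 0 * sin ψ₀ = -deriv x 0 := by
    set z : ℂ := ⟨deriv y 0, -deriv x 0⟩ with hz
    have hn : ‖z‖ = v 0 := by
      rw [Complex.norm_eq_sqrt_sq_add_sq, hv]
      congr 1
      simp only [hz]
      ring
    exact ⟨z.arg, by rw [← hn, Complex.norm_mul_cos_arg], by rw [← hn, Complex.norm_mul_sin_arg]⟩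
  set ψ : ℝ → ℝ := fun t => ψ₀ + ∫ s in (0 : ℝ)..t, k s with hψ
  have dψ : ∀ t, HasDerivAt ψ (k t) t := fun t =>
    (integral_hasDerivAt_right (hksm.continuous.intervalIntegrable _ _)
      hksm.continuous.stronglyMeasurable.stronglyMeasurableAtFilter
      hksm.continuous.continuousAt).const_add ψ₀
  have hψ' : deriv ψ = k := funext fun t => (dψ t).deriv
  have hψsm : ContDiff ℝ ∞ ψ :=
    contDiff_infty_iff_deriv.2 ⟨fun t => (dψ t).differentiableAt, hψ' ▸ hksm⟩
  have dv : ∀ t, HasDerivAt v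
      ((deriv x t * deriv (deriv x) t + deriv y t * deriv (deriv y) t) / v t) t := by
    intro t
    have h := (((dx t).pow 2).add ((dy t).pow 2)).sqrt (hpos t).ne'
    refine HasDerivAt.congr_deriv (f := v) h ?_
    have := (hv0 t).ne'
    simp only [hv] at this ⊢
    simp only [Pi.add_apply, Pi.pow_apply]
    field_simp
    push_cast
    ring
  have f0 : ∀ t, (deriv x t * cos (ψ t) + deriv y t * sin (ψ t)) / v t = 0 := by
    have hd : ∀ t, HasDerivAt
        (fun t => (deriv x t * cos (ψ t) + deriv y t * sin (ψ t)) / v t) 0 t := by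
      intro t
      have h := (((dx t).mul (dψ t).cos).add ((dy t).mul (dψ t).sin)).div (dv t) (hv0 t).ne'
      refine h.congr_deriv ?_
      have h1 := (hv0 t).ne'
      have h2 := (hpos t).ne'
      have h3 := hv2 t
      simp only [hkdef, Pi.add_apply, Pi.mul_apply]
      generalize v t = V at *
      rw [← h3] at h2 ⊢
      field_simp
      rw [h3]
      ring
    intro t
    rw [is_const_of_deriv_eq_zero (fun t => (hd t).differentiableAt) (fun t => (hd t).deriv) t 0]
    have hψ0 : ψ 0 = ψ₀ := by simp [hψ]
    rw [hψ0, div_eq_zero_iff]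
    left
    have : v 0 * (deriv x 0 * cos ψ₀ + deriv y 0 * sin ψ₀) = 0 := by
      linear_combination deriv x 0 * hc0 + deriv y 0 * hs0
    exact (mul_eq_zero.1 this).resolve_left (hv0 0).ne'
  have g1 : ∀ t, (deriv y t * cos (ψ t) - deriv x t * sin (ψ t)) / v t = 1 := by
    have hd : ∀ t, HasDerivAt
        (fun t => (deriv y t * cos (ψ t) - deriv x t * sin (ψ t)) / v t) 0 t := by
      intro t
      have h := (((dy t).mul (dψ t).cos).sub ((dx t).mul (dψ t).sin)).div (dv t) (hv0 t).ne'
      refine h.congr_deriv ?_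
      have h1 := (hv0 t).ne'
      have h2 := (hpos t).ne'
      have h3 := hv2 t
      simp only [hkdef, Pi.sub_apply, Pi.mul_apply]
      generalize v t = V at *
      rw [← h3] at h2 ⊢
      field_simp
      rw [h3]
      ring
    intro t
    rw [is_const_of_deriv_eq_zero (fun t => (hd t).differentiableAt) (fun t => (hd t).deriv) t 0]
    have hψ0 : ψ 0 = ψ₀ := by simp [hψ]
    rw [hψ0, div_eq_one_iff_eq (hv0 0).ne']
    have : v 0 * (deriv y 0 * cos ψ₀ - deriv x 0 * sin ψ₀) = v 0 * v 0 := by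
      rw [← pow_two, hv2]
      linear_combination deriv y 0 * hc0 - deriv x 0 * hs0
    exact mul_left_cancel₀ (hv0 0).ne' this
  have f0' : ∀ t, deriv x t * cos (ψ t) + deriv y t * sin (ψ t) = 0 := fun t =>
    (div_eq_zero_iff.1 (f0 t)).resolve_right (hv0 t).ne'
  have g1' : ∀ t, deriv y t * cos (ψ t) - deriv x t * sin (ψ t) = v t := fun t =>
    (div_eq_one_iff_eq (hv0 t).ne').1 (g1 t)
  refine ⟨ψ, hψsm, fun t => congrFun hψ' t, fun t => ?_, fun t => ?_⟩
  · change deriv x t = -(v t * sin (ψ t))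
    linear_combination -(deriv x t) * sin_sq_add_cos_sq (ψ t) + cos (ψ t) * f0' t
      - sin (ψ t) * g1' t
  · change deriv y t = v t * cos (ψ t)
    linear_combination -(deriv y t) * sin_sq_add_cos_sq (ψ t) + sin (ψ t) * f0' t
      + cos (ψ t) * g1' t

/-- A function whose derivative is positive, continuous and periodic is onto. -/
theorem surjective_of_deriv_periodic {ψ : ℝ → ℝ} {T : ℝ} (hT : 0 < T) (hψ : ContDiff ℝ ∞ ψ)
    (hpos : ∀ t, 0 < deriv ψ t) (hper : Function.Periodic (deriv ψ) T) :
    Function.Surjective ψ := by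
  have hd : Differentiable ℝ ψ := hψ.differentiable (by simp)
  have hc : Continuous (deriv ψ) := hψ.continuous_deriv (by simp)
  obtain ⟨m, ⟨t₀, ht₀⟩, hm⟩ :=
    (hper.compact_of_continuous hT.ne' hc).exists_isLeast (Set.range_nonempty _)
  have hm0 : 0 < m := ht₀ ▸ hpos t₀
  -- By periodicity the derivative has a positive minimum m, so ψ grows at least linearly in both
  -- directions.
  have hmono : Monotone (fun t => ψ t - m * t) := by
    refine monotone_of_deriv_nonneg (hd.sub (by fun_prop)) fun t => ?_
    have h : HasDerivAt (fun t => ψ t - m * t) (deriv ψ t - m * 1) t :=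
      (hd t).hasDerivAt.sub ((hasDerivAt_id t).const_mul m)
    rw [h.deriv]
    have := hm ⟨t, rfl⟩
    linarith
  refine hd.continuous.surjective ?_ ?_
  · refine Filter.tendsto_atTop_mono' _ ?_
      (Filter.tendsto_atTop_add_const_right _ (ψ 0) (Filter.tendsto_id.const_mul_atTop hm0))
    filter_upwards [Filter.eventually_ge_atTop 0] with t ht
    have := hmono ht
    simp only [id]
    simp only [mul_zero, sub_zero] at this
    linarith
  · refine Filter.tendsto_atBot_mono' _ ?_
      (Filter.tendsto_atBot_add_const_right _ (ψ 0) (Filter.tendsto_id.const_mul_atBot hm0))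
    filter_upwards [Filter.eventually_le_atBot 0] with t ht
    have := hmono ht
    simp only [id]
    simp only [mul_zero, sub_zero] at this
    linarith

end AngleLift

/-! ### Support functions and the passage from the curve to them. -/

theorem inner_normal (θ : ℝ) (z : Plane) : inner ℝ (normal θ) z = cos θ * z 0 + sin θ * z 1 := by
  simp [normal, PiLp.inner_apply, Fin.sum_univ_two, mul_comm]

theorem norm_normal (θ : ℝ) : ‖normal θ‖ = 1 := by
  simp [normal, EuclideanSpace.norm_eq, Fin.sum_univ_two]

theorem plane_ext {z w : Plane} (h0 : z 0 = w 0) (h1 : z 1 = w 1) : z = w := by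
  ext i
  fin_cases i
  · exact h0
  · exact h1

theorem hasDerivAt_plane {f : ℝ → Plane} {a b t : ℝ} (h0 : HasDerivAt (fun s => f s 0) a t)
    (h1 : HasDerivAt (fun s => f s 1) b t) : HasDerivAt f !₂[a, b] t := by
  rw [hasDerivAt_iff_hasFDerivAt, ← hasFDerivWithinAt_univ, hasFDerivWithinAt_euclidean]
  intro i
  rw [hasFDerivWithinAt_univ]
  fin_cases i
  · refine h0.hasFDerivAt.congr_fderiv ?_
    ext
    simp
  · refine h1.hasFDerivAt.congr_fderiv ?_
    ext
    simp

/-- Every vector of the plane is a nonnegative multiple of a unit vector `(cos θ, sin θ)`. -/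
theorem exists_eq_norm_smul_normal (z : Plane) : ∃ θ, z = ‖z‖ • normal θ := by
  set w : ℂ := ⟨z 0, z 1⟩ with hw
  have hn : ‖w‖ = ‖z‖ := by
    rw [Complex.norm_eq_sqrt_sq_add_sq, EuclideanSpace.norm_eq]
    simp [Fin.sum_univ_two, hw]
  refine ⟨w.arg, plane_ext ?_ ?_⟩
  · have := Complex.norm_mul_cos_arg w
    rw [hn] at this
    simpa [normal] using this.symm
  · have := Complex.norm_mul_sin_arg w
    rw [hn] at this
    simpa [normal] using this.symm

section Support

variable {K : Set Plane}

/-- The support function as a maximum. -/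
theorem supportFn_eq {θ : ℝ} {x : Plane} (hx : x ∈ K)
    (h : ∀ z ∈ K, inner ℝ (normal θ) z ≤ inner ℝ (normal θ) x) :
    supportFn K θ = inner ℝ (normal θ) x := by
  refine IsGreatest.csSup_eq ⟨⟨x, hx, rfl⟩, ?_⟩
  rintro _ ⟨z, hz, rfl⟩
  exact h z hz

theorem inner_le_supportFn (hK : IsCompact K) (θ : ℝ) {z : Plane} (hz : z ∈ K) :
    inner ℝ (normal θ) z ≤ supportFn K θ :=
  le_csSup (hK.image (by fun_prop)).bddAbove ⟨z, hz, rfl⟩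

theorem supportFn_periodic : Function.Periodic (supportFn K) (2 * π) := fun θ => by
  simp [supportFn, normal]

/-- A boundary point of a convex body has an outward normal. -/
theorem exists_outward_normal (hK : Convex ℝ K) (hint : (interior K).Nonempty) {x : Plane}
    (hx : x ∈ frontier K) :
    ∃ w : Plane, w ≠ 0 ∧ ∀ z ∈ K, inner ℝ w z ≤ inner ℝ w x := by
  obtain ⟨f, hf⟩ := geometric_hahn_banach_open_point hK.interior isOpen_interior hx.2
  set w := (InnerProductSpace.toDual ℝ Plane).symm f with hw
  have hwf : ∀ z, inner ℝ w z = f z := fun z => InnerProductSpace.toDual_symm_apply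
  refine ⟨w, ?_, fun z hz => ?_⟩
  · rintro h0
    obtain ⟨a, ha⟩ := hint
    have := hf a ha
    rw [← hwf, ← hwf, h0, inner_zero_left, inner_zero_left] at this
    exact lt_irrefl _ this
  · have hcl : IsClosed {z | f z ≤ f x} := isClosed_le f.continuous continuous_const
    have hsub : closure (interior K) ⊆ {z | f z ≤ f x} :=
      hcl.closure_subset_iff.2 fun z hz => (hf z hz).le
    rw [hK.closure_interior_eq_closure_of_nonempty_interior hint] at hsub
    rw [hwf, hwf]
    exact hsub (subset_closure hz)

/-- A compact convex set whose support function is smooth with positive curvature radius, and whose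
boundary is bijectively parametrized by the angle of the outward normal. -/
structure IsOval (K : Set Plane) : Prop where
  isCompact : IsCompact K
  convex : Convex ℝ K
  interior_nonempty : (interior K).Nonempty
  smooth : SmoothPeriodic (supportFn K)
  radius_pos : ∀ θ, 0 < supportFn K θ + deriv (deriv (supportFn K)) θ
  range_bdry : Set.range (bdry K) = frontier K
  normal_eq : ∀ θ θ', bdry K θ = bdry K θ' → normal θ = normal θ'

end Support

/-- A strictly convex compact set bounded by a closed curve which is not constant has interior
points. -/
theorem interior_nonempty_of_frontier {K : Set Plane} (hK : IsCompact K) (hconv : StrictConvex ℝ K)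
    {x y : Plane} (hx : x ∈ frontier K) (hy : y ∈ frontier K) (hxy : x ≠ y) :
    (interior K).Nonempty := by
  have hsub := hK.isClosed.frontier_subset
  exact ⟨_, hconv (hsub hx) (hsub hy) hxy (by norm_num : (0 : ℝ) < 1 / 2)
    (by norm_num : (0 : ℝ) < 1 / 2) (by norm_num)⟩

/-- A smooth function has nonpositive second derivative at a maximum. -/
theorem deriv_deriv_nonpos_of_isMax {F : ℝ → ℝ} (hF : ContDiff ℝ ∞ F) {t : ℝ}
    (hmax : ∀ s, F s ≤ F t) : deriv (deriv F) t ≤ 0 := by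
  by_contra hcon
  push Not at hcon
  have hloc : IsLocalMax F t := Filter.Eventually.of_forall hmax
  -- A maximum that is also a local minimum makes F locally constant, contradicting the positive
  -- second derivative.
  have hmin := isLocalMin_of_deriv_deriv_pos hcon hloc.deriv_eq_zero hF.continuous.continuousAt
  have heq : F =ᶠ[nhds t] fun _ => F t := by
    filter_upwards [hmin] with s hs using le_antisymm (hmax s) hs
  have h1 : deriv F =ᶠ[nhds t] fun _ => 0 := by
    have := heq.deriv
    simpa using this
  have h2 := h1.deriv_eq
  rw [h2] at hcon
  simp at hcon

theorem isOval_of_curve {K : Set Plane} (hK : IsCompact K) (hconv : StrictConvex ℝ K)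
    {c : ℝ → Plane} {T : ℝ} (hc : PlaneCurve.IsSmoothSimpleClosed c T)
    (hcurv : ∀ t, 0 < PlaneCurve.curvature c t) (hbdry : Set.range c = frontier K) :
    IsOval K := by
  have hconv' := hconv.convex
  have hfr : ∀ t, c t ∈ frontier K := fun t => hbdry ▸ ⟨t, rfl⟩
  have hcK : ∀ t, c t ∈ K := fun t => hK.isClosed.frontier_subset (hfr t)
  have hT := hc.period_pos
  have hint : (interior K).Nonempty := by
    refine interior_nonempty_of_frontier hK hconv (hfr 0) (hfr (T / 2)) fun h => ?_
    have := hc.injOn ⟨le_rfl, hT⟩ ⟨by positivity, by linarith⟩ h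
    linarith
  obtain ⟨x, hxd⟩ : ∃ x : ℝ → ℝ, x = fun s => c s 0 := ⟨_, rfl⟩
  obtain ⟨y, hyd⟩ : ∃ y : ℝ → ℝ, y = fun s => c s 1 := ⟨_, rfl⟩
  have hx : ContDiff ℝ ∞ x := hxd ▸ contDiff_euclidean.1 hc.smooth 0
  have hy : ContDiff ℝ ∞ y := hyd ▸ contDiff_euclidean.1 hc.smooth 1
  have cx : ∀ t, c t 0 = x t := fun t => by rw [hxd]
  have cy : ∀ t, c t 1 = y t := fun t => by rw [hyd]
  have hk : ∀ t, 0 < deriv x t * deriv (deriv y) t - deriv y t * deriv (deriv x) t := by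
    intro t
    have := hcurv t
    rw [PlaneCurve.curvature, ← hxd, ← hyd] at this
    by_contra hcon
    exact absurd this (not_lt.2 (div_nonpos_of_nonpos_of_nonneg (not_lt.1 hcon)
      (rpow_nonneg (by positivity) _)))
  have hx' : ContDiff ℝ ∞ (deriv x) := (contDiff_infty_iff_deriv.1 hx).2
  have hy' : ContDiff ℝ ∞ (deriv y) := (contDiff_infty_iff_deriv.1 hy).2
  have dx : ∀ t, HasDerivAt x (deriv x t) t := fun t => (hx.differentiable (by simp) t).hasDerivAt
  have dy : ∀ t, HasDerivAt y (deriv y t) t := fun t => (hy.differentiable (by simp) t).hasDerivAt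
  have dx' : ∀ t, HasDerivAt (deriv x) (deriv (deriv x) t) t := fun t =>
    (hx'.differentiable (by simp) t).hasDerivAt
  have dy' : ∀ t, HasDerivAt (deriv y) (deriv (deriv y) t) t := fun t =>
    (hy'.differentiable (by simp) t).hasDerivAt
  have hpos : ∀ t, 0 < deriv x t ^ 2 + deriv y t ^ 2 := by
    intro t
    by_contra hcon
    have h1 : deriv x t = 0 := by nlinarith [sq_nonneg (deriv x t), sq_nonneg (deriv y t)]
    have h2 : deriv y t = 0 := by nlinarith [sq_nonneg (deriv x t), sq_nonneg (deriv y t)]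
    have := hk t
    rw [h1, h2] at this
    simp at this
  obtain ⟨ψ, hψ, hψ', ex, ey⟩ := exists_angle_lift hx hy hk
  obtain ⟨v, hvd⟩ : ∃ v : ℝ → ℝ, v = fun t => √(deriv x t ^ 2 + deriv y t ^ 2) := ⟨_, rfl⟩
  have hv0 : ∀ t, 0 < v t := fun t => hvd ▸ sqrt_pos.2 (hpos t)
  replace ex : ∀ t, deriv x t = -(v t * sin (ψ t)) := hvd ▸ ex
  replace ey : ∀ t, deriv y t = v t * cos (ψ t) := hvd ▸ ey
  have hψpos : ∀ t, 0 < deriv ψ t := fun t => by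
    rw [hψ']
    exact div_pos (hk t) (hpos t)
  have periodic_deriv : ∀ {f : ℝ → ℝ}, Function.Periodic f T → Function.Periodic (deriv f) T := by
    intro f hf t
    have h : (fun y => f (y + T)) = f := funext hf
    rw [← deriv_comp_add_const, h]
  have px : Function.Periodic x T := fun t => by rw [hxd]; simp only [hc.periodic t]
  have py : Function.Periodic y T := fun t => by rw [hyd]; simp only [hc.periodic t]
  have hψper : Function.Periodic (deriv ψ) T := fun t => by
    rw [hψ', hψ', periodic_deriv px, periodic_deriv py, periodic_deriv (periodic_deriv px),
      periodic_deriv (periodic_deriv py)]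
  have hsurj := surjective_of_deriv_periodic hT hψ hψpos hψper
  have hmono : StrictMono ψ := strictMono_of_deriv_pos hψpos
  set e : ℝ ≃ₜ ℝ := (hmono.orderIsoOfSurjective ψ hsurj).toHomeomorph
  have dψ : ∀ t, HasDerivAt e (deriv ψ t) t := fun t => (hψ.differentiable (by simp) t).hasDerivAt
  -- The change of parameter from the normal angle back to the given parameter, smooth because ψ'
  -- never vanishes.
  obtain ⟨τ, hτd⟩ : ∃ τ : ℝ → ℝ, τ = e.symm := ⟨_, rfl⟩
  have hτ : ContDiff ℝ ∞ τ :=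
    hτd ▸ e.contDiff_symm_deriv (fun t => (hψpos t).ne') dψ (show ContDiff ℝ ∞ ψ from hψ)
  have hψτ : ∀ θ, ψ (τ θ) = θ := fun θ => by rw [hτd]; exact e.apply_symm_apply θ
  have hτψ : ∀ t, τ (ψ t) = t := fun t => by rw [hτd]; exact e.symm_apply_apply t
  have dτ : ∀ θ, HasDerivAt τ (deriv ψ (τ θ))⁻¹ θ := fun θ =>
    HasDerivAt.of_local_left_inverse hτ.continuous.continuousAt
      (hψ.differentiable (by simp) (τ θ)).hasDerivAt (hψpos _).ne'
      (Filter.Eventually.of_forall hψτ)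
  -- the outward normal at a boundary point is unique
  have huniq : ∀ (t : ℝ) (w : Plane), w ≠ 0 → (∀ z ∈ K, inner ℝ w z ≤ inner ℝ w (c t)) →
      ∃ s : ℝ, 0 < s ∧ w = s • normal (ψ t) := by
    intro t w hw hmax
    have hin : ∀ s, inner ℝ w (c s) = w 0 * x s + w 1 * y s := fun s => by
      simp [PiLp.inner_apply, Fin.sum_univ_two, ← cx, ← cy, mul_comm]
    have hF : ContDiff ℝ ∞ (fun s => w 0 * x s + w 1 * y s) :=
      (contDiff_const.mul hx).add (contDiff_const.mul hy)
    have hFmax : ∀ s, w 0 * x s + w 1 * y s ≤ w 0 * x t + w 1 * y t := fun s => by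
      rw [← hin, ← hin]
      exact hmax _ (hcK s)
    have d1 : ∀ s, HasDerivAt (fun s => w 0 * x s + w 1 * y s)
        (w 0 * deriv x s + w 1 * deriv y s) s := fun s =>
      ((dx s).const_mul _).add ((dy s).const_mul _)
    have d2 : HasDerivAt (fun s => w 0 * deriv x s + w 1 * deriv y s)
        (w 0 * deriv (deriv x) t + w 1 * deriv (deriv y) t) t :=
      ((dx' t).const_mul _).add ((dy' t).const_mul _)
    have h2 := deriv_deriv_nonpos_of_isMax hF hFmax
    rw [funext fun s => (d1 s).deriv, d2.deriv] at h2
    have hloc : IsLocalMax (fun s => w 0 * x s + w 1 * y s) t := Filter.Eventually.of_forall hFmax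
    have h1 := hloc.deriv_eq_zero
    rw [(d1 t).deriv, ex, ey] at h1
    -- The first-order condition makes w a multiple s of the normal; the second-order condition and
    -- positive curvature then force s > 0. This is where the orientation makes the normal point
    -- outward.
    have h1' : w 1 * cos (ψ t) - w 0 * sin (ψ t) = 0 := by
      have : v t * (w 1 * cos (ψ t) - w 0 * sin (ψ t)) = 0 := by linear_combination h1
      exact (mul_eq_zero.1 this).resolve_left (hv0 t).ne'
    set s := w 0 * cos (ψ t) + w 1 * sin (ψ t) with hs
    have w0 : w 0 = s * cos (ψ t) := by
      linear_combination -(w 0) * sin_sq_add_cos_sq (ψ t) - sin (ψ t) * h1'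
    have w1 : w 1 = s * sin (ψ t) := by
      linear_combination -(w 1) * sin_sq_add_cos_sq (ψ t) + cos (ψ t) * h1'
    refine ⟨s, ?_, plane_ext (by simp [normal, ← w0]) (by simp [normal, ← w1])⟩
    have hs0 : s ≠ 0 := fun h0 => hw (plane_ext (by simp [w0, h0]) (by simp [w1, h0]))
    refine lt_of_le_of_ne ?_ hs0.symm
    by_contra hneg
    rw [not_le] at hneg
    rw [w0, w1] at h2
    have h3 := hk t
    rw [ex, ey] at h3
    have h4 : 0 < -(v t) * (cos (ψ t) * deriv (deriv x) t + sin (ψ t) * deriv (deriv y) t) := by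
      linarith
    have h5 : cos (ψ t) * deriv (deriv x) t + sin (ψ t) * deriv (deriv y) t < 0 := by
      have := hv0 t
      by_contra h
      rw [not_lt] at h
      nlinarith
    nlinarith
  -- Local convexity becomes global: convexity supplies some supporting direction at c t, and
  -- uniqueness identifies it with the normal.
  have hsupp : ∀ t, ∀ z ∈ K, inner ℝ (normal (ψ t)) z ≤ inner ℝ (normal (ψ t)) (c t) := by
    intro t z hz
    obtain ⟨w, hw, hmax⟩ := exists_outward_normal hconv' hint (hfr t)
    obtain ⟨s, hs, rfl⟩ := huniq t w hw hmax
    have := hmax z hz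
    rw [inner_smul_left, inner_smul_left] at this
    exact le_of_mul_le_mul_left this hs
  have hp : supportFn K = fun θ => cos θ * x (τ θ) + sin θ * y (τ θ) := by
    funext θ
    have h := supportFn_eq (hcK (τ θ)) (by simpa only [hψτ] using hsupp (τ θ))
    rw [h, inner_normal, cx, cy]
  -- The velocity of the curve is orthogonal to the normal, so only the normal itself is
  -- differentiated. The next derivative picks up the positive curvature radius v/ψ'.
  have hp' : deriv (supportFn K) = fun θ => cos θ * y (τ θ) - sin θ * x (τ θ) := by
    funext θ
    rw [hp]
    have h1 := (dx (τ θ)).comp θ (dτ θ)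
    have h2 := (dy (τ θ)).comp θ (dτ θ)
    have h := ((hasDerivAt_cos θ).mul h1).add ((hasDerivAt_sin θ).mul h2)
    refine (HasDerivAt.congr_deriv
      (f := fun θ => cos θ * x (τ θ) + sin θ * y (τ θ)) h ?_).deriv
    rw [ex, ey, hψτ]
    simp only [Function.comp]
    ring
  have hp'' : ∀ θ, deriv (deriv (supportFn K)) θ
      = -(cos θ * x (τ θ) + sin θ * y (τ θ)) + v (τ θ) * (deriv ψ (τ θ))⁻¹ := by
    intro θ
    rw [hp']
    have h1 := (dx (τ θ)).comp θ (dτ θ)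
    have h2 := (dy (τ θ)).comp θ (dτ θ)
    have h := ((hasDerivAt_cos θ).mul h2).sub ((hasDerivAt_sin θ).mul h1)
    refine (HasDerivAt.congr_deriv
      (f := fun θ => cos θ * y (τ θ) - sin θ * x (τ θ)) h ?_).deriv
    rw [ex, ey, hψτ]
    simp only [Function.comp]
    linear_combination (v (τ θ) * (deriv ψ (τ θ))⁻¹) * sin_sq_add_cos_sq θ
  have hb : ∀ θ, bdry K θ = c (τ θ) := by
    intro θ
    refine plane_ext ?_ ?_
    · simp only [bdry, hp', cx]
      simp only [hp, Matrix.cons_val_zero]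
      linear_combination x (τ θ) * sin_sq_add_cos_sq θ
    · simp only [bdry, hp', cy]
      simp only [hp, Matrix.cons_val_one, Matrix.cons_val_zero]
      linear_combination y (τ θ) * sin_sq_add_cos_sq θ
  refine ⟨hK, hconv', hint, ⟨?_, supportFn_periodic⟩, fun θ => ?_, ?_, fun θ θ' h => ?_⟩
  · rw [hp]
    exact (contDiff_cos.mul (hx.comp hτ)).add (contDiff_sin.mul (hy.comp hτ))
  · rw [hp'', hp]
    have := mul_pos (hv0 (τ θ)) (inv_pos.2 (hψpos (τ θ)))
    simpa only [add_neg_cancel_left] using this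
  · rw [← hbdry]
    refine Set.Subset.antisymm ?_ ?_
    · rintro _ ⟨θ, rfl⟩
      exact ⟨τ θ, (hb θ).symm⟩
    · rintro _ ⟨t, rfl⟩
      exact ⟨ψ t, by rw [hb, hτψ]⟩
  · rw [hb, hb] at h
    have h1 := hsupp (τ θ)
    rw [h, hψτ] at h1
    have hne : normal θ ≠ 0 := fun h0 => by
      have := norm_normal θ
      rw [h0, norm_zero] at this
      exact zero_ne_one this
    obtain ⟨s, hs, hsn⟩ := huniq (τ θ') (normal θ) hne h1
    rw [hψτ] at hsn
    have := congrArg norm hsn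
    rw [norm_smul, norm_normal, norm_normal, mul_one, norm_eq_abs, abs_of_pos hs] at this
    rw [hsn, ← this, one_smul]

/-! ### The boundary curve and the area formula. -/

section Bdry

variable {K : Set Plane}

theorem bdry_zero (θ : ℝ) :
    bdry K θ 0 = supportFn K θ * cos θ - deriv (supportFn K) θ * sin θ := rfl

theorem bdry_one (θ : ℝ) :
    bdry K θ 1 = supportFn K θ * sin θ + deriv (supportFn K) θ * cos θ := rfl

theorem hasDerivAt_bdry_zero (hp : SmoothPeriodic (supportFn K)) (θ : ℝ) :
    HasDerivAt (fun s => bdry K s 0)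
      (-((supportFn K θ + deriv (deriv (supportFn K)) θ) * sin θ)) θ := by
  have h := ((hp.hasDerivAt θ).mul (hasDerivAt_cos θ)).sub
    ((hp.deriv.hasDerivAt θ).mul (hasDerivAt_sin θ))
  refine HasDerivAt.congr_deriv (f := fun s => bdry K s 0) h ?_
  ring

theorem hasDerivAt_bdry_one (hp : SmoothPeriodic (supportFn K)) (θ : ℝ) :
    HasDerivAt (fun s => bdry K s 1)
      ((supportFn K θ + deriv (deriv (supportFn K)) θ) * cos θ) θ := by
  have h := ((hp.hasDerivAt θ).mul (hasDerivAt_sin θ)).add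
    ((hp.deriv.hasDerivAt θ).mul (hasDerivAt_cos θ))
  refine HasDerivAt.congr_deriv (f := fun s => bdry K s 1) h ?_
  ring

theorem bdry_periodic (hp : SmoothPeriodic (supportFn K)) :
    Function.Periodic (bdry K) (2 * π) := fun θ => by
  simp only [bdry, hp.periodic θ, hp.deriv.periodic θ, cos_add_two_pi, sin_add_two_pi]

end Bdry

/-- The dilations with center `x₀ ∈ interior K` and ratio in `(0, 1)` sweep out the punctured
interior of a compact convex set `K`, starting from the frontier. -/
theorem homothety_frontier {K : Set Plane} (hK : IsCompact K) (hconv : Convex ℝ K) {x₀ : Plane}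
    (hx₀ : x₀ ∈ interior K) :
    (∀ z ∈ interior K, z ≠ x₀ → ∃ s ∈ Set.Ioo (0 : ℝ) 1, ∃ y ∈ frontier K,
      z = x₀ + s • (y - x₀)) ∧
    (∀ s ∈ Set.Ioo (0 : ℝ) 1, ∀ y ∈ frontier K,
      x₀ + s • (y - x₀) ∈ interior K ∧ x₀ + s • (y - x₀) ≠ x₀) ∧
    (∀ s ∈ Set.Ioo (0 : ℝ) 1, ∀ y ∈ frontier K, ∀ s' ∈ Set.Ioo (0 : ℝ) 1, ∀ y' ∈ frontier K,
      x₀ + s • (y - x₀) = x₀ + s' • (y' - x₀) → s = s' ∧ y = y') := by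
  -- With x₀ moved to the origin, the gauge of K is the dilation ratio: it equals 1 on the frontier,
  -- lies strictly between 0 and 1 on the punctured interior, and is positively homogeneous.
  set e := Homeomorph.addRight x₀ with he
  set K' := e ⁻¹' K with hK'
  have hc' : Convex ℝ K' := hconv.translate_preimage_left x₀
  have hi' : ∀ z, z ∈ interior K' ↔ z + x₀ ∈ interior K := fun z => by
    rw [hK', ← e.preimage_interior]
    rfl
  have hf' : ∀ z, z ∈ frontier K' ↔ z + x₀ ∈ frontier K := fun z => by
    rw [hK', ← e.preimage_frontier]
    rfl
  have h0 : K' ∈ nhds (0 : Plane) := mem_interior_iff_mem_nhds.1 ((hi' 0).2 (by simpa using hx₀))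
  have hb : Bornology.IsVonNBounded ℝ K' :=
    NormedSpace.isVonNBounded_of_isBounded ℝ
      ((e.isCompact_preimage.2 hK).isBounded)
  have hG1 : ∀ y ∈ frontier K, gauge K' (y - x₀) = 1 := fun y hy =>
    (gauge_eq_one_iff_mem_frontier hc' h0).2 ((hf' _).2 (by simpa using hy))
  have hGs : ∀ s ∈ Set.Ioo (0 : ℝ) 1, ∀ y ∈ frontier K, gauge K' (s • (y - x₀)) = s := by
    intro s hs y hy
    rw [gauge_smul_of_nonneg hs.1.le, hG1 y hy, smul_eq_mul, mul_one]
  refine ⟨fun z hz hne => ?_, fun s hs y hy => ⟨?_, fun h => ?_⟩,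
    fun s hs y hy s' hs' y' hy' h => ?_⟩
  · set G := gauge K' (z - x₀) with hG
    have hpos : 0 < G := (gauge_pos (absorbent_nhds_zero h0) hb).2 (sub_ne_zero.2 hne)
    have hlt : G < 1 := (gauge_lt_one_iff_mem_interior hc' h0).2 ((hi' _).2 (by simpa using hz))
    refine ⟨G, ⟨hpos, hlt⟩, G⁻¹ • (z - x₀) + x₀, ?_, ?_⟩
    · rw [← hf', ← gauge_eq_one_iff_mem_frontier hc' h0,
        gauge_smul_of_nonneg (inv_nonneg.2 hpos.le), ← hG, smul_eq_mul, inv_mul_cancel₀ hpos.ne']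
    · rw [add_sub_cancel_right, smul_smul, mul_inv_cancel₀ hpos.ne', one_smul, add_sub_cancel]
  · have := (hi' (s • (y - x₀))).1 ((gauge_lt_one_iff_mem_interior hc' h0).1 (by
      rw [hGs s hs y hy]
      exact hs.2))
    rwa [add_comm] at this
  · have h' : s • (y - x₀) = 0 := by simpa using h
    have := hGs s hs y hy
    rw [h', gauge_zero] at this
    exact hs.1.ne this
  · have h' := add_left_cancel h
    have hss : s = s' := by rw [← hGs s hs y hy, h', hGs s' hs' y' hy']
    subst hss
    have := smul_right_injective _ hs.1.ne' h'
    exact ⟨rfl, sub_left_injective this⟩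

/-- The area of an oval in terms of its support function. -/
theorem area_eq {K : Set Plane} (hK : IsOval K) :
    area K = (1 / 2) * ∫ θ in (0 : ℝ)..(2 * π),
      supportFn K θ * (supportFn K θ + deriv (deriv (supportFn K)) θ) := by
  obtain ⟨x₀, hx₀⟩ := hK.interior_nonempty
  have hp := hK.smooth
  obtain ⟨hsur, hmem, hinj⟩ := homothety_frontier hK.isCompact hK.convex hx₀
  have hfr : ∀ θ, bdry K θ ∈ frontier K := fun θ => hK.range_bdry ▸ ⟨θ, rfl⟩
  set a := x₀ 0 with ha
  set b := x₀ 1 with hb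
  set S : Set (ℝ × ℝ) := Set.Ioo 0 1 ×ˢ Set.Ico 0 (2 * π) with hS
  -- Generalized polar coordinates about x₀: the ratio of dilation and the normal angle of the
  -- boundary point. The Jacobian is s · (p − ⟨n, x₀⟩) · ρ.
  set F : ℝ × ℝ → ℝ × ℝ := fun q =>
    (a + q.1 * (bdry K q.2 0 - a), b + q.1 * (bdry K q.2 1 - b)) with hF
  set Φ : ℝ × ℝ → Plane := fun q => !₂[q.1, q.2] with hΦ
  have hΦF : ∀ q, Φ (F q) = x₀ + q.1 • (bdry K q.2 - x₀) := fun q =>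
    plane_ext (by simp [hΦ, hF, ha]) (by simp [hΦ, hF, hb])
  have hΦmp : MeasurePreserving Φ volume volume :=
    (PiLp.volume_preserving_toLp (Fin 2)).comp (volume_preserving_finTwoArrow ℝ).symm
  have hΦinj : Function.Injective Φ := fun q q' h => by
    have h0 := congrArg (fun z : Plane => z 0) h
    have h1 := congrArg (fun z : Plane => z 1) h
    exact Prod.ext (by simpa [hΦ] using h0) (by simpa [hΦ] using h1)
  set h : ℝ → ℝ := fun θ =>
    (supportFn K θ - (a * cos θ + b * sin θ)) * (supportFn K θ + deriv (deriv (supportFn K)) θ)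
    with hh
  have hhp : SmoothPeriodic h :=
    (hp.sub (((SmoothPeriodic.const a).mul SmoothPeriodic.cos).add
      ((SmoothPeriodic.const b).mul SmoothPeriodic.sin))).mul (hp.add hp.deriv.deriv)
  have hhnn : ∀ θ, 0 ≤ h θ := fun θ => by
    refine mul_nonneg ?_ (hK.radius_pos θ).le
    have := inner_le_supportFn hK.isCompact θ (interior_subset hx₀)
    rw [inner_normal] at this
    linarith
  set F' : ℝ × ℝ → (ℝ × ℝ →L[ℝ] ℝ × ℝ) := fun q =>
    (Matrix.toLin (.finTwoProd ℝ) (.finTwoProd ℝ)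
      !![bdry K q.2 0 - a,
          q.1 * -((supportFn K q.2 + deriv (deriv (supportFn K)) q.2) * sin q.2);
        bdry K q.2 1 - b,
          q.1 * ((supportFn K q.2 + deriv (deriv (supportFn K)) q.2) * cos q.2)]
      ).toContinuousLinearMap with hF'
  have hFd : ∀ q, HasFDerivAt F (F' q) q := by
    intro q
    simp only [hF']
    rw [Matrix.toLin_finTwoProd_toContinuousLinearMap]
    have h0 := ((hasDerivAt_bdry_zero hp q.2).sub_const a).comp_hasFDerivAt q
      (hasFDerivAt_snd (𝕜 := ℝ))
    have h1 := ((hasDerivAt_bdry_one hp q.2).sub_const b).comp_hasFDerivAt q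
      (hasFDerivAt_snd (𝕜 := ℝ))
    convert! HasFDerivAt.prodMk (𝕜 := ℝ)
      (((hasFDerivAt_fst (𝕜 := ℝ)).mul h0).const_add a)
      (((hasFDerivAt_fst (𝕜 := ℝ)).mul h1).const_add b) using 2 <;>
    simp [smul_smul, add_comm, neg_smul _ (ContinuousLinearMap.snd ℝ ℝ ℝ)]
  have hdet : ∀ q ∈ S, |(F' q).det| = q.1 * h q.2 := by
    rintro q ⟨hq1, -⟩
    have : (F' q).det = q.1 * h q.2 := by
      simp only [hF', LinearMap.det_toContinuousLinearMap, LinearMap.det_toLin,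
        Matrix.det_fin_two_of, hh, bdry_zero, bdry_one]
      linear_combination (q.1 * (supportFn K q.2 + deriv (deriv (supportFn K)) q.2)
        * supportFn K q.2) * sin_sq_add_cos_sq q.2
    rw [this, abs_of_nonneg (mul_nonneg hq1.1.le (hhnn _))]
  have hFinj : Set.InjOn F S := by
    rintro ⟨s, θ⟩ ⟨hs, hθ⟩ ⟨s', θ'⟩ ⟨hs', hθ'⟩ heq
    have h1 := congrArg Φ heq
    rw [hΦF, hΦF] at h1
    obtain ⟨hss, hbb⟩ := hinj s hs _ (hfr θ) s' hs' _ (hfr θ') h1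
    have hn := hK.normal_eq θ θ' hbb
    have hcos : cos θ = cos θ' := by simpa [normal] using congrArg (fun z : Plane => z 0) hn
    have hsin : sin θ = sin θ' := by simpa [normal] using congrArg (fun z : Plane => z 1) hn
    have hcos' : cos (θ - θ') = 1 := by
      rw [cos_sub, hcos, hsin]
      linarith [sin_sq_add_cos_sq θ', sq (sin θ'), sq (cos θ')]
    -- Both angles lie in the half-open interval [0, 2π), so their difference is strictly between
    -- −2π and 2π.
    have := (cos_eq_one_iff_of_lt_of_lt (by linarith [hθ.1, hθ'.2]) (by
      linarith [hθ.2, hθ'.1])).1 hcos'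
    exact Prod.ext hss (by linarith)
  have himg : F '' S = Φ ⁻¹' (interior K \ {x₀}) := by
    ext q
    constructor
    · rintro ⟨⟨s, θ⟩, ⟨hs, hθ⟩, rfl⟩
      rw [Set.mem_preimage, hΦF]
      exact hmem s hs _ (hfr θ)
    · rintro ⟨hq, hne⟩
      obtain ⟨s, hs, y, hy, hz⟩ := hsur _ hq hne
      rw [← hK.range_bdry] at hy
      obtain ⟨θ, rfl⟩ := hy
      obtain ⟨θ', hθ', he⟩ := (bdry_periodic hp).exists_mem_Ico two_pi_pos θ 0
      rw [zero_add] at hθ'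
      exact ⟨(s, θ'), ⟨hs, hθ'⟩, hΦinj (by rw [hΦF, hz, ← he])⟩
  have hSm : MeasurableSet S := measurableSet_Ioo.prod measurableSet_Ico
  -- The image misses only x₀ and the frontier, and the frontier of a convex set is null.
  have hvol : volume K = volume (F '' S) := by
    rw [himg, hΦmp.measure_preimage
      (isOpen_interior.measurableSet.diff (measurableSet_singleton _)).nullMeasurableSet,
      measure_sdiff_null (measure_singleton _), ← self_sdiff_frontier,
      measure_sdiff_null (hK.convex.addHaar_frontier volume)]
  have hlin := lintegral_abs_det_fderiv_eq_addHaar_image volume hSm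
    (fun q _ => (hFd q).hasFDerivWithinAt) hFinj
  rw [setLIntegral_congr_fun hSm (fun q hq => by rw [hdet q hq])] at hlin
  have hcont : Continuous (fun q : ℝ × ℝ => q.1 * h q.2) :=
    continuous_fst.mul (hhp.continuous.comp continuous_snd)
  have hint : IntegrableOn (fun q : ℝ × ℝ => q.1 * h q.2) S volume :=
    (hcont.continuousOn.integrableOn_compact (isCompact_Icc.prod isCompact_Icc)).mono_set
      (Set.prod_mono Set.Ioo_subset_Icc_self Set.Ico_subset_Icc_self)
  rw [← ofReal_integral_eq_lintegral_ofReal hint ((ae_restrict_iff' hSm).2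
    (Filter.Eventually.of_forall fun q hq => mul_nonneg hq.1.1.le (hhnn _)))] at hlin
  have hnn : 0 ≤ ∫ q in S, q.1 * h q.2 :=
    setIntegral_nonneg hSm fun q hq => mul_nonneg hq.1.1.le (hhnn _)
  rw [area, hvol, ← hlin, ENNReal.toReal_ofReal hnn, hS, Measure.volume_eq_prod,
    setIntegral_prod_mul (fun s => s) h]
  have e1 : ∫ s in Set.Ioo (0 : ℝ) 1, s = 1 / 2 := by
    rw [← integral_Ioc_eq_integral_Ioo, ← intervalIntegral.integral_of_le zero_le_one, integral_id]
    norm_num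
  have e2 : ∫ θ in Set.Ico 0 (2 * π), h θ = ∫ θ in (0 : ℝ)..(2 * π),
      supportFn K θ * (supportFn K θ + deriv (deriv (supportFn K)) θ) := by
    rw [integral_Ico_eq_integral_Ioo, ← integral_Ioc_eq_integral_Ioo,
      ← intervalIntegral.integral_of_le two_pi_pos.le]
    have hr := hp.add hp.deriv.deriv
    have i1 := (hp.mul hr).intervalIntegrable 0 (2 * π)
    have i2 := (SmoothPeriodic.cos.mul hr).intervalIntegrable 0 (2 * π)
    have i3 := (SmoothPeriodic.sin.mul hr).intervalIntegrable 0 (2 * π)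
    -- The terms depending on x₀ integrate to zero because the boundary curve closes up.
    have hexp : ∀ θ, h θ = supportFn K θ * (supportFn K θ + deriv (deriv (supportFn K)) θ)
        - a * (cos θ * (supportFn K θ + deriv (deriv (supportFn K)) θ))
        - b * (sin θ * (supportFn K θ + deriv (deriv (supportFn K)) θ)) := fun θ => by
      simp only [hh]
      ring
    simp_rw [hexp]
    rw [integral_sub (i1.sub (i2.const_mul a)) (i3.const_mul b), integral_sub i1 (i2.const_mul a),
      intervalIntegral.integral_const_mul, intervalIntegral.integral_const_mul,
      hp.integral_cos_mul_add_deriv_deriv, hp.integral_sin_mul_add_deriv_deriv]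
    ring
  rw [e1, e2]

/-! ### Circumradius, inradius, Bonnesen's inequality and disks. -/

section Radii

variable {K : Set Plane}

theorem inner_normal_add_pi (θ : ℝ) (z : Plane) :
    inner ℝ (normal (θ + π)) z = -inner ℝ (normal θ) z := by
  rw [inner_normal, inner_normal, cos_add_pi, sin_add_pi]
  ring

/-- Cauchy–Schwarz in one direction; in the other, test with the normal pointing along z − x. -/
theorem subset_closedBall_iff (hK : IsCompact K) (hne : K.Nonempty) {x : Plane} {R : ℝ} :
    K ⊆ Metric.closedBall x R ↔ ∀ θ, supportFn K θ - inner ℝ (normal θ) x ≤ R := by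
  constructor
  · intro h θ
    rw [sub_le_iff_le_add]
    refine csSup_le (hne.image _) ?_
    rintro _ ⟨z, hz, rfl⟩
    have h1 := h hz
    rw [mem_closedBall_iff_norm] at h1
    have h2 := real_inner_le_norm (normal θ) (z - x)
    rw [norm_normal, one_mul, inner_sub_right] at h2
    change inner ℝ (normal θ) z ≤ _
    linarith
  · intro h z hz
    rw [mem_closedBall_iff_norm]
    obtain ⟨θ, hθ⟩ := exists_eq_norm_smul_normal (z - x)
    have h1 := inner_le_supportFn hK θ hz
    have h2 : inner ℝ (normal θ) (z - x) = ‖z - x‖ := by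
      rw [hθ, inner_smul_right, real_inner_self_eq_norm_sq, norm_normal, norm_smul, norm_normal,
        norm_norm]
      ring
    rw [inner_sub_right] at h2
    linarith [h θ]

/-- Unlike for circumscribed balls, convexity is needed: a point of the ball outside K is separated
from K by a line, whose normal violates the inequality. -/
theorem closedBall_subset_iff (hK : IsCompact K) (hconv : Convex ℝ K) (hne : K.Nonempty)
    {x : Plane} {r : ℝ} (hr : 0 ≤ r) :
    Metric.closedBall x r ⊆ K ↔ ∀ θ, r ≤ supportFn K θ - inner ℝ (normal θ) x := by
  constructor
  · intro h θ
    have hmem : x + r • normal θ ∈ K := h (by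
      rw [mem_closedBall_iff_norm, add_sub_cancel_left, norm_smul, norm_normal, mul_one,
        norm_eq_abs, abs_of_nonneg hr])
    have := inner_le_supportFn hK θ hmem
    rw [inner_add_right, inner_smul_right, real_inner_self_eq_norm_sq, norm_normal] at this
    linarith
  · intro h y hy
    by_contra hcon
    obtain ⟨f, u, hf, hu⟩ := geometric_hahn_banach_closed_point hconv hK.isClosed hcon
    set w := (InnerProductSpace.toDual ℝ Plane).symm f with hw
    have hwf : ∀ z, inner ℝ w z = f z := fun z => InnerProductSpace.toDual_symm_apply
    obtain ⟨θ, hθ⟩ := exists_eq_norm_smul_normal w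
    have hlt : ∀ z ∈ K, f z < f y := fun z hz => (hf z hz).trans hu
    have hw0 : 0 < ‖w‖ := by
      refine norm_pos_iff.2 fun h0 => ?_
      obtain ⟨z, hz⟩ := hne
      have := hlt z hz
      rw [← hwf, ← hwf, h0, inner_zero_left, inner_zero_left] at this
      exact lt_irrefl _ this
    have hfn : ∀ z, f z = ‖w‖ * inner ℝ (normal θ) z := fun z => by
      rw [← hwf, hθ, inner_smul_left, norm_smul, norm_normal, norm_norm]
      simp
    obtain ⟨z, hz, hmax⟩ := hK.exists_isMaxOn hne
      (f := fun z => inner ℝ (normal θ) z) (by fun_prop)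
    have h1 := supportFn_eq hz fun z' hz' => hmax hz'
    have h2 := hlt z hz
    rw [hfn, hfn] at h2
    have h3 := lt_of_mul_lt_mul_left h2 hw0.le
    have h4 := real_inner_le_norm (normal θ) (y - x)
    rw [norm_normal, one_mul, inner_sub_right] at h4
    rw [mem_closedBall_iff_norm] at hy
    linarith [h θ]

/-- The circumradius is attained. -/
theorem exists_circumcenter (hK : IsCompact K) (hne : K.Nonempty) :
    (∃ x, K ⊆ Metric.closedBall x (circumradius K)) ∧
      ∀ R x, 0 ≤ R → K ⊆ Metric.closedBall x R → circumradius K ≤ R := by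
  obtain ⟨k, hk⟩ := hne
  obtain ⟨R₀, hR₀⟩ := hK.isBounded.subset_closedBall k
  have hR₀nn : 0 ≤ R₀ := by
    have := hR₀ hk
    rwa [Metric.mem_closedBall, dist_self] at this
  -- A compact set of pairs (radius, center): a ball of radius at most R₀ containing k has its
  -- center within R₀ of k.
  set P : Set (ℝ × Plane) := (Set.Icc 0 R₀ ×ˢ Metric.closedBall k R₀) ∩
    {q | ∀ z ∈ K, dist z q.2 ≤ q.1} with hP
  have hcl : IsClosed {q : ℝ × Plane | ∀ z ∈ K, dist z q.2 ≤ q.1} := by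
    have : {q : ℝ × Plane | ∀ z ∈ K, dist z q.2 ≤ q.1}
        = ⋂ z ∈ K, {q : ℝ × Plane | dist z q.2 ≤ q.1} := by
      ext q
      simp
    rw [this]
    exact isClosed_biInter fun z _ =>
      isClosed_le (continuous_const.dist continuous_snd) continuous_fst
  have hPc : IsCompact P :=
    (isCompact_Icc.prod (isCompact_closedBall k R₀)).inter_right hcl
  have hPne : P.Nonempty := ⟨(R₀, k), ⟨⟨⟨hR₀nn, le_rfl⟩, Metric.mem_closedBall_self hR₀nn⟩,
    fun z hz => hR₀ hz⟩⟩
  obtain ⟨⟨r, x⟩, ⟨⟨hr, -⟩, hx⟩, hmin⟩ := hPc.exists_isMinOn hPne continuous_fst.continuousOn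
  have hmin' : ∀ R y, 0 ≤ R → K ⊆ Metric.closedBall y R → r ≤ R := by
    intro R y hR hy
    rcases le_or_gt R R₀ with h | h
    · have hyk : y ∈ Metric.closedBall k R₀ := by
        have := hy hk
        rw [Metric.mem_closedBall, dist_comm] at this
        exact Metric.mem_closedBall.2 (this.trans h)
      have hq : (R, y) ∈ P := ⟨⟨⟨hR, h⟩, hyk⟩, fun z hz => hy hz⟩
      exact hmin hq
    · exact hr.2.trans h.le
  have hle : IsLeast {R : ℝ | 0 ≤ R ∧ ∃ x : Plane, K ⊆ Metric.closedBall x R} r :=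
    ⟨⟨hr.1, x, fun z hz => hx z hz⟩, fun R hR => hR.2.elim fun y hy => hmin' R y hR.1 hy⟩
  have heq : circumradius K = r := hle.csInf_eq
  rw [heq]
  exact ⟨⟨x, fun z hz => hx z hz⟩, hmin'⟩

/-- The inradius is attained. -/
theorem exists_incenter (hK : IsCompact K) (hconv : Convex ℝ K) (hne : K.Nonempty) :
    0 ≤ inradius K ∧ (∃ x, Metric.closedBall x (inradius K) ⊆ K) ∧
      ∀ r x, 0 ≤ r → Metric.closedBall x r ⊆ K → r ≤ inradius K := by
  -- Half the width of K in one direction bounds every inscribed radius.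
  set B := (supportFn K 0 + supportFn K (0 + π)) / 2 with hB
  have hbound : ∀ r x, 0 ≤ r → Metric.closedBall x r ⊆ K → r ≤ B := by
    intro r x hr h
    rw [closedBall_subset_iff hK hconv hne hr] at h
    have h0 := h 0
    have h1 := h (0 + π)
    rw [inner_normal_add_pi] at h1
    linarith
  set P : Set (ℝ × Plane) := (Set.Icc 0 B ×ˢ K) ∩
    {q | ∀ θ, q.1 ≤ supportFn K θ - inner ℝ (normal θ) q.2} with hP
  have hcl : IsClosed {q : ℝ × Plane | ∀ θ, q.1 ≤ supportFn K θ - inner ℝ (normal θ) q.2} := by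
    rw [Set.ofPred_forall]
    exact isClosed_iInter fun θ => isClosed_le continuous_fst (by fun_prop)
  have hPc : IsCompact P := (isCompact_Icc.prod hK).inter_right hcl
  have hmem : ∀ r x, 0 ≤ r → Metric.closedBall x r ⊆ K → (r, x) ∈ P := fun r x hr h =>
    ⟨⟨⟨hr, hbound r x hr h⟩, h (Metric.mem_closedBall_self hr)⟩,
      (closedBall_subset_iff hK hconv hne hr).1 h⟩
  obtain ⟨k, hk⟩ := hne
  have hPne : P.Nonempty := ⟨_, hmem 0 k le_rfl (by simpa using hk)⟩
  obtain ⟨⟨r, x⟩, ⟨⟨hr, -⟩, hx⟩, hmax⟩ := hPc.exists_isMaxOn hPne continuous_fst.continuousOn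
  have hball : Metric.closedBall x r ⊆ K := (closedBall_subset_iff hK hconv ⟨k, hk⟩ hr.1).2 hx
  have hmax' : ∀ R y, 0 ≤ R → Metric.closedBall y R ⊆ K → R ≤ r := fun R y hR h =>
    hmax (hmem R y hR h)
  have hgr : IsGreatest {r : ℝ | 0 ≤ r ∧ ∃ x : Plane, Metric.closedBall x r ⊆ K} r :=
    ⟨⟨hr.1, x, hball⟩, fun R hR => hR.2.elim fun y hy => hmax' R y hR.1 hy⟩
  have heq : inradius K = r := hgr.csSup_eq
  rw [heq]
  exact ⟨hr.1, ⟨x, hball⟩, hmax'⟩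

theorem shift_eq (x : Plane) (r θ : ℝ) :
    shift (supportFn K) (x 0) (x 1) r θ = supportFn K θ - inner ℝ (normal θ) x - r := by
  rw [shift, inner_normal]
  ring

/-- The circumscribed circle touches the boundary on every half circle. -/
theorem exists_circumcircle (hK : IsOval K) :
    ∃ u v : ℝ, ∀ a, ∃ z ∈ Set.Icc a (a + π),
      shift (supportFn K) u v (circumradius K) z = 0 := by
  have hne : K.Nonempty := hK.interior_nonempty.mono interior_subset
  obtain ⟨⟨x, hx⟩, hmin⟩ := exists_circumcenter hK.isCompact hne
  refine ⟨x 0, x 1, (hK.smooth.shift _ _ _).exists_zero_of_optimal (fun θ => ?_)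
    fun u v ε hε hcon => ?_⟩
  · rw [shift_eq]
    linarith [(subset_closedBall_iff hK.isCompact hne).1 hx θ]
  · set y : Plane := x - !₂[u, v] with hy
    have hyθ : ∀ θ, supportFn K θ - inner ℝ (normal θ) y ≤ circumradius K - ε := by
      intro θ
      have := hcon θ
      rw [shift_eq] at this
      rw [hy, inner_sub_right, inner_normal θ !₂[u, v]]
      simp only [Matrix.cons_val_zero, Matrix.cons_val_one]
      linarith
    obtain ⟨z, hz⟩ := hne
    have hR : 0 ≤ circumradius K - ε := by
      have h0 := hyθ 0
      have h1 := hyθ (0 + π)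
      have h2 := inner_le_supportFn hK.isCompact 0 hz
      have h3 := inner_le_supportFn hK.isCompact (0 + π) hz
      rw [inner_normal_add_pi] at h1 h3
      linarith
    have := hmin _ y hR ((subset_closedBall_iff hK.isCompact ⟨z, hz⟩).2 hyθ)
    linarith

/-- The inscribed circle touches the boundary on every half circle. -/
theorem exists_incircle (hK : IsOval K) :
    ∃ u v : ℝ, ∀ a, ∃ z ∈ Set.Icc a (a + π), shift (supportFn K) u v (inradius K) z = 0 := by
  have hne : K.Nonempty := hK.interior_nonempty.mono interior_subset
  obtain ⟨hr0, ⟨x, hx⟩, hmax⟩ := exists_incenter hK.isCompact hK.convex hne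
  refine ⟨x 0, x 1, fun a => ?_⟩
  suffices h : ∃ z ∈ Set.Icc a (a + π), -shift (supportFn K) (x 0) (x 1) (inradius K) z = 0 by
    obtain ⟨z, hz, h0⟩ := h
    exact ⟨z, hz, neg_eq_zero.1 h0⟩
  refine (hK.smooth.shift (x 0) (x 1) (inradius K)).neg.exists_zero_of_optimal
    (fun θ => ?_) (fun u v ε hε hcon => ?_) a
  · rw [shift_eq]
    linarith [(closedBall_subset_iff hK.isCompact hK.convex hne hr0).1 hx θ]
  · set y : Plane := x + !₂[u, v] with hy
    have hyθ : ∀ θ, inradius K + ε ≤ supportFn K θ - inner ℝ (normal θ) y := by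
      intro θ
      have := hcon θ
      rw [shift_eq] at this
      rw [hy, inner_add_right, inner_normal θ !₂[u, v]]
      simp only [Matrix.cons_val_zero, Matrix.cons_val_one]
      linarith
    have := hmax _ y (by linarith)
      ((closedBall_subset_iff hK.isCompact hK.convex hne (by linarith)).2 hyθ)
    linarith

/-- Bonnesen's inequality, together with its equality case. -/
theorem bonnesen_radii (hK : IsOval K) {L Q : ℝ}
    (hL : ∫ θ in (0 : ℝ)..(2 * π), supportFn K θ = L)
    (hQ : ∫ θ in (0 : ℝ)..(2 * π),
      supportFn K θ * (supportFn K θ + deriv (deriv (supportFn K)) θ) = Q) :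
    π ^ 2 * (circumradius K - inradius K) ^ 2 ≤ L ^ 2 - 2 * π * Q ∧
      (π ^ 2 * (circumradius K - inradius K) ^ 2 = L ^ 2 - 2 * π * Q →
        ∀ θ, supportFn K θ + deriv (deriv (supportFn K)) θ = circumradius K) := by
  obtain ⟨u, v, H⟩ := exists_circumcircle hK
  obtain ⟨u', v', H'⟩ := exists_incircle hK
  have h1 := hK.smooth.bonnesen u v _ H
  have h2 := hK.smooth.bonnesen u' v' _ H'
  have h3 := hK.smooth.add_deriv_deriv_eq_of_bonnesen_eq u v _ H
  rw [hL, hQ] at h1 h2 h3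
  -- The parallelogram law combines the two bounds. Equality in the result forces equality in the
  -- bound for the circumscribed circle.
  have hid : 4 * (π ^ 2 * (circumradius K - inradius K) ^ 2)
      = 2 * (2 * π * circumradius K - L) ^ 2 + 2 * (2 * π * inradius K - L) ^ 2
        - ((2 * π * circumradius K - L) + (2 * π * inradius K - L)) ^ 2 := by ring
  have hsq := sq_nonneg ((2 * π * circumradius K - L) + (2 * π * inradius K - L))
  refine ⟨by linarith, fun heq => h3 ?_⟩
  linarith

/-- An oval of constant curvature radius is a disk. -/
theorem isDisk_of_radius_eq (hK : IsOval K) {r : ℝ}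
    (hr : ∀ θ, supportFn K θ + deriv (deriv (supportFn K)) θ = r) : IsDisk K := by
  have hr0 : 0 < r := hr 0 ▸ hK.radius_pos 0
  have hp := hK.smooth
  have hne : K.Nonempty := hK.interior_nonempty.mono interior_subset
  -- The curvature center is constant, since its derivative is a multiple of ρ − r; it is the center
  -- of the disk.
  have hcenter : ∀ θ, supportFn K θ * cos θ - deriv (supportFn K) θ * sin θ - r * cos θ
        = supportFn K 0 - r ∧
      supportFn K θ * sin θ + deriv (supportFn K) θ * cos θ - r * sin θ
        = deriv (supportFn K) 0 := by
    have d0 : ∀ θ, HasDerivAt (fun θ => bdry K θ 0 - r * cos θ) 0 θ := fun θ =>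
      ((hasDerivAt_bdry_zero hp θ).sub ((hasDerivAt_cos θ).const_mul r)).congr_deriv (by
        rw [hr]; ring)
    have d1 : ∀ θ, HasDerivAt (fun θ => bdry K θ 1 - r * sin θ) 0 θ := fun θ =>
      ((hasDerivAt_bdry_one hp θ).sub ((hasDerivAt_sin θ).const_mul r)).congr_deriv (by
        rw [hr]; ring)
    intro θ
    have h0 := is_const_of_deriv_eq_zero (fun t => (d0 t).differentiableAt)
      (fun t => (d0 t).deriv) θ 0
    have h1 := is_const_of_deriv_eq_zero (fun t => (d1 t).differentiableAt)
      (fun t => (d1 t).deriv) θ 0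
    simp only [bdry_zero, bdry_one, cos_zero, sin_zero] at h0 h1
    exact ⟨by rw [h0]; ring, by rw [h1]; ring⟩
  set x : Plane := !₂[supportFn K 0 - r, deriv (supportFn K) 0] with hx
  have hsupp : ∀ θ, supportFn K θ - inner ℝ (normal θ) x = r := by
    intro θ
    rw [inner_normal, hx]
    simp only [Matrix.cons_val_zero, Matrix.cons_val_one]
    obtain ⟨h0, h1⟩ := hcenter θ
    linear_combination (r - supportFn K θ) * sin_sq_add_cos_sq θ + cos θ * h0 + sin θ * h1
  exact ⟨x, r, hr0, Set.Subset.antisymm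
    ((subset_closedBall_iff hK.isCompact hne).2 fun θ => (hsupp θ).le)
    ((closedBall_subset_iff hK.isCompact hK.convex hne hr0.le).2 fun θ => (hsupp θ).ge)⟩

/-- The support function of a disk. -/
theorem supportFn_closedBall (x : Plane) {r : ℝ} (hr : 0 < r) :
    supportFn (Metric.closedBall x r) = fun θ => cos θ * x 0 + sin θ * x 1 + r := by
  funext θ
  have hmem : x + r • normal θ ∈ Metric.closedBall x r := by
    rw [mem_closedBall_iff_norm, add_sub_cancel_left, norm_smul, norm_normal, mul_one,
      norm_eq_abs, abs_of_pos hr]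
  have hval : inner ℝ (normal θ) (x + r • normal θ) = inner ℝ (normal θ) x + r := by
    rw [inner_add_right, inner_smul_right, real_inner_self_eq_norm_sq, norm_normal]
    ring
  rw [supportFn_eq hmem fun z hz => ?_, hval, inner_normal]
  rw [hval]
  have h2 := real_inner_le_norm (normal θ) (z - x)
  rw [norm_normal, one_mul, inner_sub_right] at h2
  rw [mem_closedBall_iff_norm] at hz
  linarith

end Radii

/-! ### The terms of `W` in terms of the support function. -/

section Invariants

variable {K : Set Plane}

theorem sq_rpow_three_halves (a : ℝ) : (a ^ 2) ^ (3 / 2 : ℝ) = |a| ^ 3 := by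
  rw [← sq_abs, ← rpow_natCast |a| 2, ← rpow_mul (abs_nonneg a), ← rpow_natCast |a| 3]
  norm_num

theorem kappa_eq (hK : IsOval K) (θ : ℝ) :
    kappa K θ = 1 / (supportFn K θ + deriv (deriv (supportFn K)) θ) := by
  have hp := hK.smooth
  have hr := hp.add hp.deriv.deriv
  set ρ : ℝ → ℝ := fun θ => supportFn K θ + deriv (deriv (supportFn K)) θ with hρ
  have h0 : deriv (fun s => bdry K s 0) = fun s => -(ρ s * sin s) :=
    funext fun s => (hasDerivAt_bdry_zero hp s).deriv
  have h1 : deriv (fun s => bdry K s 1) = fun s => ρ s * cos s :=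
    funext fun s => (hasDerivAt_bdry_one hp s).deriv
  have h00 : deriv (fun s => -(ρ s * sin s)) θ = -(deriv ρ θ * sin θ + ρ θ * cos θ) :=
    ((hr.hasDerivAt θ).mul (hasDerivAt_sin θ)).neg.deriv
  have h11 : deriv (fun s => ρ s * cos s) θ = deriv ρ θ * cos θ + ρ θ * -sin θ :=
    ((hr.hasDerivAt θ).mul (hasDerivAt_cos θ)).deriv
  have hpos : 0 < ρ θ := hK.radius_pos θ
  rw [kappa, PlaneCurve.curvature, h0, h1, h00, h11]
  have hden : (-(ρ θ * sin θ)) ^ 2 + (ρ θ * cos θ) ^ 2 = ρ θ ^ 2 := by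
    linear_combination ρ θ ^ 2 * sin_sq_add_cos_sq θ
  have hnum : -(ρ θ * sin θ) * (deriv ρ θ * cos θ + ρ θ * -sin θ)
      - ρ θ * cos θ * -(deriv ρ θ * sin θ + ρ θ * cos θ) = ρ θ ^ 2 := by
    linear_combination ρ θ ^ 2 * sin_sq_add_cos_sq θ
  rw [hden, hnum, sq_rpow_three_halves, abs_of_pos hpos, pow_succ (ρ θ) 2, div_mul_cancel_left₀ (pow_pos hpos 2).ne', inv_eq_one_div]

theorem rho_eq (hK : IsOval K) :
    rho K = fun θ => supportFn K θ + deriv (deriv (supportFn K)) θ := by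
  funext θ
  rw [rho, kappa_eq hK, one_div_one_div]

theorem norm_deriv_bdry (hK : IsOval K) (θ : ℝ) :
    ‖deriv (bdry K) θ‖ = supportFn K θ + deriv (deriv (supportFn K)) θ := by
  rw [(hasDerivAt_plane (hasDerivAt_bdry_zero hK.smooth θ)
    (hasDerivAt_bdry_one hK.smooth θ)).deriv, EuclideanSpace.norm_eq]
  simp only [Fin.sum_univ_two, norm_eq_abs, sq_abs, Matrix.cons_val_zero, Matrix.cons_val_one]
  rw [sqrt_eq_iff_mul_self_eq_of_pos (hK.radius_pos θ)]
  linear_combination (-(supportFn K θ + deriv (deriv (supportFn K)) θ) ^ 2)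
    * sin_sq_add_cos_sq θ

theorem length_eq (hK : IsOval K) : length K = ∫ θ in (0 : ℝ)..(2 * π), supportFn K θ := by
  simp only [length, PlaneCurve.arcIntegral, one_mul, norm_deriv_bdry hK]
  exact hK.smooth.integral_add_deriv_deriv

/-- Strictness is what rules out a zero of W when ζ > 0. -/
theorem arcIntegral_sq_kappa_pos (hK : IsOval K) :
    0 < PlaneCurve.arcIntegral (bdry K) (fun θ => kappa K θ ^ 2) := by
  have hr := hK.smooth.add hK.smooth.deriv.deriv
  simp only [PlaneCurve.arcIntegral, norm_deriv_bdry hK, kappa_eq hK]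
  refine intervalIntegral_pos_of_pos (Continuous.intervalIntegrable ?_ _ _) (fun θ => ?_)
    two_pi_pos
  · exact ((continuous_const.div hr.continuous fun θ => (hK.radius_pos θ).ne').pow 2).mul
      hr.continuous
  · have := hK.radius_pos θ
    positivity

theorem hasDerivAt_centers (hK : IsOval K) (θ : ℝ) :
    HasDerivAt (fun s => centers K s 0) (-(deriv (rho K) θ * cos θ)) θ ∧
      HasDerivAt (fun s => centers K s 1) (-(deriv (rho K) θ * sin θ)) θ := by
  have hr : SmoothPeriodic (rho K) := rho_eq hK ▸ hK.smooth.add hK.smooth.deriv.deriv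
  have hρ := congrFun (rho_eq hK) θ
  have h0 := (hasDerivAt_bdry_zero hK.smooth θ).sub ((hr.hasDerivAt θ).mul (hasDerivAt_cos θ))
  have h1 := (hasDerivAt_bdry_one hK.smooth θ).sub ((hr.hasDerivAt θ).mul (hasDerivAt_sin θ))
  rw [← hρ] at h0 h1
  exact ⟨HasDerivAt.congr_deriv (f := fun s => centers K s 0) h0 (by ring),
    HasDerivAt.congr_deriv (f := fun s => centers K s 1) h1 (by ring)⟩

/-- The velocity of the locus of centers is −ρ' times the unit normal, which turns at unit rate. So
its speed is |ρ'| and its curvature 1/|ρ'|; the value 0 prescribed at singular points agrees, as ρ'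
= 0 there. -/
theorem sq_rhoBeta_eq (hK : IsOval K) (θ : ℝ) : rhoBeta K θ ^ 2 = deriv (rho K) θ ^ 2 := by
  have hr : SmoothPeriodic (rho K) := rho_eq hK ▸ hK.smooth.add hK.smooth.deriv.deriv
  have hd : deriv (centers K) θ = !₂[-(deriv (rho K) θ * cos θ), -(deriv (rho K) θ * sin θ)] :=
    (hasDerivAt_plane (hasDerivAt_centers hK θ).1 (hasDerivAt_centers hK θ).2).deriv
  rw [rhoBeta]
  split_ifs with h
  · rw [hd] at h
    have e0 : -(deriv (rho K) θ * cos θ) = 0 := by simpa using congrArg (fun z : Plane => z 0) h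
    have e1 : -(deriv (rho K) θ * sin θ) = 0 := by simpa using congrArg (fun z : Plane => z 1) h
    linear_combination deriv (rho K) θ * cos θ * e0 + deriv (rho K) θ * sin θ * e1
      + deriv (rho K) θ ^ 2 * sin_sq_add_cos_sq θ
  · have hne : deriv (rho K) θ ≠ 0 := fun h0 => h (by
      rw [hd, h0]
      exact plane_ext (by simp) (by simp))
    have h0 : deriv (fun s => centers K s 0) = fun s => -(deriv (rho K) s * cos s) :=
      funext fun s => (hasDerivAt_centers hK s).1.deriv
    have h1 : deriv (fun s => centers K s 1) = fun s => -(deriv (rho K) s * sin s) :=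
      funext fun s => (hasDerivAt_centers hK s).2.deriv
    have h00 : deriv (fun s => -(deriv (rho K) s * cos s)) θ
        = -(deriv (deriv (rho K)) θ * cos θ + deriv (rho K) θ * -sin θ) :=
      ((hr.deriv.hasDerivAt θ).mul (hasDerivAt_cos θ)).neg.deriv
    have h11 : deriv (fun s => -(deriv (rho K) s * sin s)) θ
        = -(deriv (deriv (rho K)) θ * sin θ + deriv (rho K) θ * cos θ) :=
      ((hr.deriv.hasDerivAt θ).mul (hasDerivAt_sin θ)).neg.deriv
    rw [PlaneCurve.curvature, h0, h1, h00, h11]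
    beta_reduce
    generalize deriv (rho K) θ = d at *
    generalize deriv (deriv (rho K)) θ = d' at *
    have hden : (-(d * cos θ)) ^ 2 + (-(d * sin θ)) ^ 2 = d ^ 2 := by
      linear_combination d ^ 2 * sin_sq_add_cos_sq θ
    have hnum : -(d * cos θ) * -(d' * sin θ + d * cos θ)
        - -(d * sin θ) * -(d' * cos θ + d * -sin θ) = d ^ 2 := by
      linear_combination d ^ 2 * sin_sq_add_cos_sq θ
    have habs : |d| ≠ 0 := abs_ne_zero.2 hne
    have : 1 / (d ^ 2 / |d| ^ 3) = |d| := by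
      rw [← sq_abs d]
      field_simp
    rw [hden, hnum, sq_rpow_three_halves, this, abs_abs, sq_abs]

/-- The area form along the locus of centers reduces to p'ρ'; integrate by parts and substitute p''
= ρ − p. -/
theorem areaTilde_eq (hK : IsOval K) {Q : ℝ}
    (hQ : ∫ θ in (0 : ℝ)..(2 * π),
      supportFn K θ * (supportFn K θ + deriv (deriv (supportFn K)) θ) = Q) :
    areaTilde K = (1 / 2) * (Q - ∫ θ in (0 : ℝ)..(2 * π), rho K θ ^ 2) := by
  have hp := hK.smooth
  have hρ := rho_eq hK
  have hr : SmoothPeriodic (rho K) := hρ ▸ hp.add hp.deriv.deriv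
  have h0 : deriv (fun s => centers K s 0) = fun s => -(deriv (rho K) s * cos s) :=
    funext fun s => (hasDerivAt_centers hK s).1.deriv
  have h1 : deriv (fun s => centers K s 1) = fun s => -(deriv (rho K) s * sin s) :=
    funext fun s => (hasDerivAt_centers hK s).2.deriv
  have hc0 : ∀ θ, centers K θ 0 = bdry K θ 0 - rho K θ * cos θ := fun θ => rfl
  have hc1 : ∀ θ, centers K θ 1 = bdry K θ 1 - rho K θ * sin θ := fun θ => rfl
  have hint : ∀ θ, centers K θ 0 * -(deriv (rho K) θ * sin θ)
      - centers K θ 1 * -(deriv (rho K) θ * cos θ)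
      = deriv (supportFn K) θ * deriv (rho K) θ := by
    intro θ
    rw [hc0, hc1, bdry_zero, bdry_one]
    linear_combination deriv (supportFn K) θ * deriv (rho K) θ * sin_sq_add_cos_sq θ
  rw [areaTilde, PlaneCurve.orientedArea, h0, h1]
  simp only [hint]
  have i1 := (hr.pow 2).intervalIntegrable 0 (2 * π)
  have i2 := (hp.mul hr).intervalIntegrable 0 (2 * π)
  have hparts := hp.deriv.integral_mul_deriv hr
  have hsplit : ∫ θ in (0 : ℝ)..(2 * π), deriv (deriv (supportFn K)) θ * rho K θ
      = (∫ θ in (0 : ℝ)..(2 * π), rho K θ ^ 2)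
        - ∫ θ in (0 : ℝ)..(2 * π), supportFn K θ * rho K θ := by
    rw [← integral_sub i1 i2]
    congr 1
    funext θ
    have : rho K θ = supportFn K θ + deriv (deriv (supportFn K)) θ := congrFun hρ θ
    linear_combination -(rho K θ) * this
  have hQ' : ∫ θ in (0 : ℝ)..(2 * π), supportFn K θ * rho K θ = Q := by rw [hρ]; exact hQ
  rw [hparts, hsplit, hQ']
  ring

/-- The functional `W` in terms of the length, the area, the variance of the curvature radius and
the energy of the curvature radius. -/
theorem W_eq (hK : IsOval K) (α δ μ σ η lam ξ ζ : ℝ) {L Q S U : ℝ}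
    (hL : ∫ θ in (0 : ℝ)..(2 * π), supportFn K θ = L)
    (hQ : ∫ θ in (0 : ℝ)..(2 * π),
      supportFn K θ * (supportFn K θ + deriv (deriv (supportFn K)) θ) = Q)
    (hS : ∫ θ in (0 : ℝ)..(2 * π),
      (supportFn K θ + deriv (deriv (supportFn K)) θ - L / (2 * π)) ^ 2 = S)
    (hU : ∫ θ in (0 : ℝ)..(2 * π),
      deriv (fun y => supportFn K y + deriv (deriv (supportFn K)) y) θ ^ 2 = U) :
    W K α δ μ σ η lam ξ ζ =
      (2 * α + 4 * π * δ + μ) * (L ^ 2 / (4 * π)) + (α + σ / 2) * S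
        + (σ - μ) * (L ^ 2 / (4 * π) - Q / 2) + η * U
        + lam * (circumradius K - inradius K) ^ 2 + ξ * (rhoMax K - rhoMin K) ^ 2
        + ζ * PlaneCurve.arcIntegral (bdry K) (fun θ => kappa K θ ^ 2) := by
  have hπ := pi_pos
  have hp := hK.smooth
  obtain ⟨hD, hSD⟩ := hp.deficit_bounds hL hQ hS
  have hsq : ∫ θ in (0 : ℝ)..(2 * π), rho K θ ^ 2 = S + L ^ 2 / (2 * π) := by
    have := (hp.add hp.deriv.deriv).variance_eq (L / (2 * π))
    rw [hS, hp.integral_add_deriv_deriv, hL] at this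
    rw [rho_eq hK, this]
    field_simp
    ring
  -- The oriented area is nonpositive, as S and the deficit are nonnegative; this removes the
  -- absolute value.
  have hT : |areaTilde K| = S / 2 + (L ^ 2 / (4 * π) - Q / 2) := by
    rw [areaTilde_eq hK hQ, hsq]
    have : 1 / 2 * (Q - (S + L ^ 2 / (2 * π))) = -(S / 2 + (L ^ 2 / (4 * π) - Q / 2)) := by
      field_simp
      ring
    rw [this, abs_neg, abs_of_nonneg (by linarith)]
  have hU' : ∫ θ in (0 : ℝ)..(2 * π), rhoBeta K θ ^ 2 = U := by
    simp only [sq_rhoBeta_eq hK]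
    rw [← hU, rho_eq hK]
  rw [W, hsq, hT, hU', length_eq hK, hL, area_eq hK, hQ]
  field_simp
  ring

theorem rho_mem_Icc (hK : IsOval K) (θ : ℝ) : rho K θ ∈ Set.Icc (rhoMin K) (rhoMax K) := by
  have hr : SmoothPeriodic (rho K) := rho_eq hK ▸ hK.smooth.add hK.smooth.deriv.deriv
  exact ⟨csInf_le hr.isCompact_range.bddBelow ⟨θ, rfl⟩,
    le_csSup hr.isCompact_range.bddAbove ⟨θ, rfl⟩⟩

/-- A lower bound of `W` by terms which are nonnegative and detect disks. -/
theorem W_lower_bound (hK : IsOval K) {α δ μ σ η lam ξ ζ : ℝ}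
    (h : Admissible α δ μ σ η lam ξ ζ) :
    ∃ D : ℝ, 0 ≤ D ∧
      π * (circumradius K - inradius K) ^ 2 ≤ 4 * D ∧
      (π * (circumradius K - inradius K) ^ 2 = 4 * D → IsDisk K) ∧
      12 * D ≤ π * (rhoMax K - rhoMin K) ^ 2 ∧
      lam * (π * (circumradius K - inradius K) ^ 2 - 4 * D) + 8 * (ξ * D)
        + ξ * (π * (rhoMax K - rhoMin K) ^ 2 - 12 * D)
        + π * (ζ * PlaneCurve.arcIntegral (bdry K) (fun θ => kappa K θ ^ 2))
        ≤ π * W K α δ μ σ η lam ξ ζ := by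
  have hπ := pi_pos
  have hp := hK.smooth
  obtain ⟨L, hL⟩ : ∃ L, ∫ θ in (0 : ℝ)..(2 * π), supportFn K θ = L := ⟨_, rfl⟩
  obtain ⟨Q, hQ⟩ : ∃ Q, ∫ θ in (0 : ℝ)..(2 * π),
      supportFn K θ * (supportFn K θ + deriv (deriv (supportFn K)) θ) = Q := ⟨_, rfl⟩
  obtain ⟨S, hS⟩ : ∃ S, ∫ θ in (0 : ℝ)..(2 * π),
      (supportFn K θ + deriv (deriv (supportFn K)) θ - L / (2 * π)) ^ 2 = S := ⟨_, rfl⟩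
  obtain ⟨U, hU⟩ : ∃ U, ∫ θ in (0 : ℝ)..(2 * π),
      deriv (fun y => supportFn K y + deriv (deriv (supportFn K)) y) θ ^ 2 = U := ⟨_, rfl⟩
  rw [W_eq hK α δ μ σ η lam ξ ζ hL hQ hS hU]
  obtain ⟨hD, hSD⟩ := hp.deficit_bounds hL hQ hS
  have hUS := hp.four_mul_variance_le hL
  rw [hS, hU] at hUS
  have hint : ∫ θ in (0 : ℝ)..(2 * π), (supportFn K θ + deriv (deriv (supportFn K)) θ) = L := by
    rw [hp.integral_add_deriv_deriv, hL]
  have hmem : ∀ θ, supportFn K θ + deriv (deriv (supportFn K)) θ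
      ∈ Set.Icc (rhoMin K) (rhoMax K) := fun θ => by
    have := rho_mem_Icc hK θ
    rwa [rho_eq hK] at this
  have hvar := (hp.add hp.deriv.deriv).variance_le (fun θ => (hmem θ).1) (fun θ => (hmem θ).2) hint
  rw [hS] at hvar
  obtain ⟨hB, hBeq⟩ := bonnesen_radii hK hL hQ
  have hdef : L ^ 2 - 2 * π * Q = π * (4 * (L ^ 2 / (4 * π) - Q / 2)) := by
    field_simp
    ring
  rw [hdef, pow_two π, mul_assoc] at hB hBeq
  have hB' := le_of_mul_le_mul_left hB hπ
  have hL0 : 0 ≤ L ^ 2 / (4 * π) := by positivity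
  refine ⟨L ^ 2 / (4 * π) - Q / 2, hD, hB',
    fun heq => isDisk_of_radius_eq hK (hBeq (by rw [heq])), by linarith, ?_⟩
  generalize L ^ 2 / (4 * π) - Q / 2 = D at *
  generalize L ^ 2 / (4 * π) = M at *
  generalize (circumradius K - inradius K) ^ 2 = B at *
  generalize (rhoMax K - rhoMin K) ^ 2 = X at *
  generalize PlaneCurve.arcIntegral (bdry K) (fun θ => kappa K θ ^ 2) = Z at *
  obtain ⟨hη, hξ, hζ, hlam, c1, c2, c3⟩ := h
  -- Replace U by 4S, then S by 6D. As ζ ≥ 0, the conditions remain true without their ζ terms. In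
  -- the total coefficient of D, λ contributes 4λ and ξ contributes 12ξ; only 4ξ is needed for the
  -- third condition, and the spare 8ξD is kept to detect D = 0.
  have t1 : 0 ≤ (2 * α + 4 * π * δ + μ) * M := mul_nonneg (by linarith) hL0
  have t2 : 0 ≤ η * (U - 4 * S) := mul_nonneg hη (by linarith)
  have t3 : 0 ≤ (2 * α + σ - 2 * η) * (S - 6 * D) := mul_nonneg (by linarith) (by linarith)
  have t4 : 0 ≤ η * (S - 6 * D) := mul_nonneg hη (by linarith)
  have t5 : 0 ≤ (6 * π * α - π * μ + 4 * π * σ + 24 * π * η + 4 * lam + 4 * ξ) * D :=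
    mul_nonneg (by linarith [mul_nonneg hπ.le hζ]) hD
  have key : 0 ≤ π * ((2 * α + 4 * π * δ + μ) * M + η * (U - 4 * S)
      + (2 * α + σ - 2 * η) * (S - 6 * D) / 2 + 5 * (η * (S - 6 * D))) :=
    mul_nonneg hπ.le (by linarith)
  linarith

/-- The functional on disks. -/
theorem W_closedBall {x : Plane} {r : ℝ} (hr : 0 < r) (hK : IsOval (Metric.closedBall x r))
    (α δ μ σ η lam ξ : ℝ) :
    W (Metric.closedBall x r) α δ μ σ η lam ξ 0 = (2 * α + 4 * π * δ + μ) * (π * r ^ 2) := by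
  have hπ := pi_pos
  set p := supportFn (Metric.closedBall x r) with hpdef
  have hp : p = fun θ => cos θ * x 0 + sin θ * x 1 + r := supportFn_closedBall x hr
  have hp' : deriv p = fun θ => -sin θ * x 0 + cos θ * x 1 := by
    rw [hp]
    exact funext fun θ => ((((hasDerivAt_cos θ).mul_const (x 0)).add
      ((hasDerivAt_sin θ).mul_const (x 1))).add_const r).deriv
  have hp'' : deriv (deriv p) = fun θ => -cos θ * x 0 + -sin θ * x 1 := by
    rw [hp']
    exact funext fun θ => (((hasDerivAt_sin θ).neg.mul_const (x 0)).add
      ((hasDerivAt_cos θ).mul_const (x 1))).deriv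
  have hrad : ∀ θ, p θ + deriv (deriv p) θ = r := fun θ => by
    rw [hp'', hp]
    ring
  have hL : ∫ θ in (0 : ℝ)..(2 * π), p θ = 2 * π * r := by
    rw [← hK.smooth.integral_add_deriv_deriv]
    simp only [← hpdef, hrad]
    simp
  have hQ : ∫ θ in (0 : ℝ)..(2 * π), p θ * (p θ + deriv (deriv p) θ) = 2 * π * r ^ 2 := by
    simp only [hrad, intervalIntegral.integral_mul_const, hL]
    ring
  have hS : ∫ θ in (0 : ℝ)..(2 * π),
      (p θ + deriv (deriv p) θ - 2 * π * r / (2 * π)) ^ 2 = 0 := by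
    simp [hrad]
  have hU : ∫ θ in (0 : ℝ)..(2 * π), deriv (fun y => p y + deriv (deriv p) y) θ ^ 2 = 0 := by
    simp [hrad]
  -- The deficit of a disk is zero, so Bonnesen's inequality makes its two radii coincide.
  have hB : (circumradius (Metric.closedBall x r) - inradius (Metric.closedBall x r)) ^ 2 = 0 := by
    have h := (bonnesen_radii hK hL hQ).1
    have h0 : (2 * π * r) ^ 2 - 2 * π * (2 * π * r ^ 2) = 0 := by ring
    rw [h0] at h
    have hπ2 : 0 < π ^ 2 := by positivity
    exact le_antisymm (nonpos_of_mul_nonpos_right h hπ2) (sq_nonneg _)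
  have hX : (rhoMax (Metric.closedBall x r) - rhoMin (Metric.closedBall x r)) ^ 2 = 0 := by
    have hρ : rho (Metric.closedBall x r) = fun _ => r := by
      rw [rho_eq hK]
      exact funext hrad
    rw [rhoMax, rhoMin, hρ, Set.range_const, csSup_singleton, csInf_singleton, sub_self]
    exact zero_pow two_ne_zero
  rw [W_eq hK α δ μ σ η lam ξ 0 hL hQ hS hU, hB, hX]
  field_simp
  ring

end Invariants

end ConvexDomain

end

/-! ### The inequality, its value on disks and the rigidity statement. -/

theorem theorem1p1 (K : Set Plane) (hKcompact : IsCompact K) (hKconvex : StrictConvex ℝ K)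
    (c : ℝ → Plane) (T : ℝ) (hc : PlaneCurve.IsSmoothSimpleClosed c T)
    (hcurv : ∀ t, 0 < PlaneCurve.curvature c t) (hbdry : Set.range c = frontier K) :
    (∀ α δ μ σ η lam ξ ζ : ℝ, ConvexDomain.Admissible α δ μ σ η lam ξ ζ →
      0 ≤ ConvexDomain.W K α δ μ σ η lam ξ ζ) ∧
    (∀ α δ μ σ η lam ξ ζ : ℝ, ConvexDomain.IsDisk K →
      2 * α + 4 * Real.pi * δ + μ = 0 → ζ = 0 →
      ConvexDomain.W K α δ μ σ η lam ξ ζ = 0) ∧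
    (∀ α δ μ σ η lam ξ ζ : ℝ, ConvexDomain.Admissible α δ μ σ η lam ξ ζ →
      0 < lam ^ 2 + ξ ^ 2 + ζ ^ 2 →
      ConvexDomain.W K α δ μ σ η lam ξ ζ = 0 → ConvexDomain.IsDisk K) := by
  have hK := ConvexDomain.isOval_of_curve hKcompact hKconvex hc hcurv hbdry
  have hπ := Real.pi_pos
  have hZ := ConvexDomain.arcIntegral_sq_kappa_pos hK
  refine ⟨fun α δ μ σ η lam ξ ζ h => ?_, fun α δ μ σ η lam ξ ζ hdisk h0 hζ => ?_,
    fun α δ μ σ η lam ξ ζ h hpos hW => ?_⟩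
  · obtain ⟨D, hD, hB, -, hX, hle⟩ := ConvexDomain.W_lower_bound hK h
    have t1 := mul_nonneg_of_nonpos_of_nonpos h.lam_nonpos (sub_nonpos.2 hB)
    have t2 := mul_nonneg h.xi_nonneg hD
    have t3 := mul_nonneg h.xi_nonneg (sub_nonneg.2 hX)
    have t4 := mul_nonneg hπ.le (mul_nonneg h.zeta_nonneg hZ.le)
    exact nonneg_of_mul_nonneg_right (by linarith) hπ
  · obtain ⟨x, r, hr, rfl⟩ := hdisk
    rw [hζ, ConvexDomain.W_closedBall hr hK, h0, zero_mul]
  · obtain ⟨D, hD, hB, hBeq, hX, hle⟩ := ConvexDomain.W_lower_bound hK h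
    have t1 := mul_nonneg_of_nonpos_of_nonpos h.lam_nonpos (sub_nonpos.2 hB)
    have t2 := mul_nonneg h.xi_nonneg hD
    have t3 := mul_nonneg h.xi_nonneg (sub_nonneg.2 hX)
    have t4 := mul_nonneg hπ.le (mul_nonneg h.zeta_nonneg hZ.le)
    rw [hW, mul_zero] at hle
    -- A positive ζ would make W positive, so under W = 0 only λ or ξ can be nonzero.
    have hζ : ζ = 0 := by
      by_contra hne
      have hζ0 : 0 < ζ := lt_of_le_of_ne h.zeta_nonneg (Ne.symm hne)
      have := mul_pos hπ (mul_pos hζ0 hZ)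
      linarith
    by_cases hlam : lam = 0
    · have hξ : ξ ≠ 0 := fun hξ => by
        rw [hlam, hξ, hζ] at hpos
        norm_num at hpos
      -- The spare term 8ξD vanishes first; then the Popoviciu term leaves ρ_M = ρ_m, so ρ is
      -- constant.
      have hD0 : D = 0 := (mul_eq_zero.1 (show ξ * D = 0 by linarith)).resolve_left hξ
      have hX0 := (mul_eq_zero.1 (show ξ * (Real.pi *
        (ConvexDomain.rhoMax K - ConvexDomain.rhoMin K) ^ 2 - 12 * D) = 0 by
          linarith)).resolve_left hξ
      rw [hD0, mul_zero, sub_zero, mul_eq_zero, or_iff_right hπ.ne', sq_eq_zero_iff, sub_eq_zero]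
        at hX0
      refine ConvexDomain.isDisk_of_radius_eq hK (r := ConvexDomain.rhoMax K) fun θ => ?_
      have h1 := ConvexDomain.rho_mem_Icc hK θ
      rw [← hX0, Set.Icc_self, Set.mem_singleton_iff, ConvexDomain.rho_eq hK] at h1
      exact h1
    · have h0 := (mul_eq_zero.1 (show lam * (Real.pi *
        (ConvexDomain.circumradius K - ConvexDomain.inradius K) ^ 2 - 4 * D) = 0 by
          linarith)).resolve_left hlam
      exact hBeq (sub_eq_zero.1 h0)
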